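/- For a discrete group $G$ let $\ell^1(G)$ be its Banach algebra of absolutely summable functions $G\to\mathbb C$ under convolution. Its topological Hochschild cohomology $HH^*_t(\ell^1(G))$ is the cohomology of the complex of continuous linear functionals on the topological Hochschild complex $C_n=\ell^1(G)^{\hat\otimes(n+1)}$ (completed projective tensor powers), with boundary $$b(a_0\otimes\cdots\otimes a_n)=\sum_{i=0}^{n-1}(-1)^i a_0\otimes\cdots\otimes a_ia_{i+1}\otimes\cdots\otimes a_n+(-1)^n a_na_0\otimes a_1\otimes\cdots\otimes a_{n-1}.$$ For a conjugacy class $x$ of $G$ let $C_*(x)\subseteq C_*$ be the subcomplex with $C_n(x)$ the closed linear span of the tensors $\delta_{g_0}\otimes\cdots\otimes\delta_{g_n}$ with $g_0\cdots g_n\in x$, and let $HH^*_t(\ell^1(G))_x$ be the cohomology of the complex of continuous linear functionals on $C_*(x)$. For a group $K$ let $H^*_b(BK)$ be the cohomology of the complex of bounded functions $K^n\to\mathbb C$ ($n\ge 0$) with the coboundary of the inhomogeneous bar construction. Then, for every discrete group $G$ and every $n\ge 0$: (a) $HH^n_t(\ell^1(G))_x$ is a direct summand of $HH^n_t(\ell^1(G))$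 for every conjugacy class $x$: the restriction maps $r_x:HH^n_t(\ell^1(G))\to HH^n_t(\ell^1(G))_x$ admit linear right inverses $\iota_x$ such that $r_y\circ\iota_x=0$ for $y\neq x$. (b) For every conjugacy class $x=\langle h\rangle$ of $G$, with $G_h$ the centralizer of $h$ in $G$, there is an isomorphism $$HH^n_t(\ell^1(G))_x\cong H^n_b(BG_h).$$ It is induced by the map that sends a functional $\varphi$ on $C_n(x)$ to the bounded function $(g_1,\dots,g_n)\mapsto\varphi(\delta_{(g_1\cdots g_n)^{-1}h}\otimes\delta_{g_1}\otimes\cdots\otimes\delta_{g_n})$ on $G_h^n$, and it is natural: for every group homomorphism $f:G\to H$ and every $h\in G$ the isomorphisms for $(G,h)$ and $(H,f(h))$ commute with the maps $HH^n_t(\ell^1(H))_{\langle f(h)\rangle}\to HH^n_t(\ell^1(G))_{\langle h\rangle}$ and $H^n_b(BH_{f(h)})\to H^n_b(BG_h)$ induced by $f$. -/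

import Mathlib

open CategoryTheory
open scoped TensorProduct

universe u

namespace EllOneHochschild

noncomputable section

/-! ### Alternating sums -/

theorem alternating_sum_eq_zero {M : Type*} [AddCommGroup M] [Module ℂ M] {n : ℕ}
    (F : Fin (n + 2) → Fin (n + 3) → M)
    (hF : ∀ i j : Fin (n + 2), i ≤ j → F i j.succ = F j i.castSucc) :
    ∑ i : Fin (n + 2), (-1 : ℂ) ^ (i : ℕ) • ∑ j : Fin (n + 3), (-1 : ℂ) ^ (j : ℕ) • F i j = 0 := by
  simp only [Finset.smul_sum, ← Finset.sum_product']
  let P := Fin (n + 2) × Fin (n + 3)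
  let S : Finset P := {ij : P | (ij.2 : ℕ) ≤ (ij.1 : ℕ)}
  rw [Finset.univ_product_univ, ← Finset.sum_add_sum_compl S, ← eq_neg_iff_add_eq_zero,
    ← Finset.sum_neg_distrib]
  let φ : ∀ ij : P, ij ∈ S → P := fun ij hij =>
    (Fin.castLT ij.2 (lt_of_le_of_lt (Finset.mem_filter.mp hij).right (Fin.is_lt ij.1)), ij.1.succ)
  apply Finset.sum_bij φ
  · intro ij hij
    simp_rw [S, φ, Finset.compl_filter, Finset.mem_filter_univ, Fin.val_succ,
      Fin.val_castLT] at hij ⊢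
    lia
  · rintro ⟨i, j⟩ hij ⟨i', j'⟩ hij' h
    rw [Prod.mk_inj]
    exact ⟨by simpa [φ] using! congr_arg Prod.snd h,
      by simpa [φ, Fin.castSucc_castLT] using! congr_arg Fin.castSucc (congr_arg Prod.fst h)⟩
  · rintro ⟨i', j'⟩ hij'
    simp_rw [S, Finset.compl_filter, Finset.mem_filter_univ, not_le] at hij'
    refine ⟨(j'.pred <| ?_, Fin.castSucc i'), ?_, ?_⟩
    · rintro rfl
      simp only [Fin.val_zero, not_lt_zero] at hij'
    · simpa [S] using! Nat.le_sub_one_of_lt hij'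
    · simp only [φ, Fin.castLT_castSucc, Fin.succ_pred]
  · rintro ⟨i, j⟩ hij
    have h := hF (Fin.castLT j (lt_of_le_of_lt (Finset.mem_filter.mp hij).right (Fin.is_lt i))) i
      (by simpa [S] using! hij)
    simp only [φ, h, Fin.castSucc_castLT, smul_smul, ← neg_smul, Fin.val_succ, Fin.val_castLT]
    congr 1
    ring

/-! ### Bar construction -/

/-- The `i`-th face of the (inhomogeneous) bar construction `BM`:
`∂₀ (g₁, …, gₙ₊₁) = (g₂, …, gₙ₊₁)`, `∂ᵢ (g₁, …, gₙ₊₁) = (g₁, …, gᵢ gᵢ₊₁, …, gₙ₊₁)` for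
`1 ≤ i ≤ n`, and `∂ₙ₊₁ (g₁, …, gₙ₊₁) = (g₁, …, gₙ)`. -/
def barFace {M : Type*} [Mul M] {n : ℕ} (i : Fin (n + 2)) (g : Fin (n + 1) → M) : Fin n → M :=
  fun k =>
    if (k : ℕ) + 1 < i then g k.castSucc
    else if (k : ℕ) + 1 = i then g k.castSucc * g k.succ
    else g k.succ

theorem barFace_barFace {M : Type*} [Semigroup M] {n : ℕ} (i j : Fin (n + 2)) (hij : i ≤ j)
    (g : Fin (n + 2) → M) :
    barFace i (barFace j.succ g) = barFace j (barFace i.castSucc g) := by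
  funext k
  simp only [Fin.le_def] at hij
  simp only [barFace, Fin.val_castSucc, Fin.val_succ]
  grind [Fin.castSucc_succ, mul_assoc]

/-- The `i`-th face of the cyclic bar construction of `M`:
`∂ᵢ (a₀, …, aₙ₊₁) = (a₀, …, aᵢ aᵢ₊₁, …, aₙ₊₁)` for `0 ≤ i ≤ n`, and
`∂ₙ₊₁ (a₀, …, aₙ₊₁) = (aₙ₊₁ a₀, a₁, …, aₙ)`. -/
def cyclicFace {M : Type*} [Mul M] {n : ℕ} (i : Fin (n + 2)) (a : Fin (n + 2) → M) :
    Fin (n + 1) → M :=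
  fun k =>
    if i = Fin.last (n + 1) then
      if k = 0 then a (Fin.last (n + 1)) * a 0 else a k.castSucc
    else if (k : ℕ) < i then a k.castSucc
    else if (k : ℕ) = i then a k.castSucc * a k.succ
    else a k.succ

theorem cyclicFace_cyclicFace {M : Type*} [Semigroup M] {n : ℕ} (i j : Fin (n + 2)) (hij : i ≤ j)
    (a : Fin (n + 3) → M) :
    cyclicFace i (cyclicFace j.succ a) = cyclicFace j (cyclicFace i.castSucc a) := by
  funext k
  obtain ⟨i, hi⟩ := i
  obtain ⟨j, hj⟩ := j
  obtain ⟨k, hk⟩ := k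
  have h0 : (0 : Fin (n + 3)) = ⟨0, by lia⟩ := rfl
  simp only [Fin.mk_le_mk] at hij
  simp only [cyclicFace, Fin.ext_iff, Fin.val_zero,
    Fin.castSucc_mk, Fin.succ_mk, Fin.last, Fin.castSucc_zero, h0]
  grind [mul_assoc]

theorem map_cyclicFace {M N : Type*} [Mul M] [Mul N] (f : M → N)
    (hf : ∀ a b, f (a * b) = f a * f b) {n : ℕ} (i : Fin (n + 2)) (a : Fin (n + 2) → M) :
    (fun k => f (cyclicFace i a k)) = cyclicFace i (fun k => f (a k)) := by
  funext k
  simp only [cyclicFace]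
  split_ifs <;> simp [hf]

theorem exists_cyclicFace_update {A : Type*} [Ring A] {n : ℕ} (i : Fin (n + 2))
    (a : Fin (n + 2) → A) (m : Fin (n + 2)) :
    ∃ (p : Fin (n + 1)) (l r : A), ∀ v,
      cyclicFace i (Function.update a m v) = Function.update (cyclicFace i a) p (l * v * r) := by
  have h0 : (0 : Fin (n + 2)) = ⟨0, by lia⟩ := rfl
  obtain ⟨i, hi⟩ := i
  obtain ⟨m, hm⟩ := m
  by_cases hl : i = n + 1
  · by_cases hm0 : m = 0
    · refine ⟨0, a (Fin.last _), 1, fun v => funext fun ⟨k, hk⟩ => ?_⟩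
      simp only [cyclicFace, Function.update_apply, Fin.ext_iff, Fin.val_zero, Fin.castSucc_mk, Fin.succ_mk, Fin.last, h0]
      grind
    · by_cases hml : m = n + 1
      · refine ⟨0, 1, a 0, fun v => funext fun ⟨k, hk⟩ => ?_⟩
        simp only [cyclicFace, Function.update_apply, Fin.ext_iff, Fin.val_zero, Fin.castSucc_mk, Fin.succ_mk, Fin.last, h0]
        grind
      · refine ⟨⟨m, by lia⟩, 1, 1, fun v => funext fun ⟨k, hk⟩ => ?_⟩
        simp only [cyclicFace, Function.update_apply, Fin.ext_iff, Fin.val_zero, Fin.castSucc_mk, Fin.succ_mk, Fin.last, h0]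
        grind
  · rcases lt_trichotomy m i with h | h | h
    · refine ⟨⟨m, by lia⟩, 1, 1, fun v => funext fun ⟨k, hk⟩ => ?_⟩
      simp only [cyclicFace, Function.update_apply, Fin.ext_iff, Fin.val_zero, Fin.castSucc_mk, Fin.succ_mk, Fin.last, h0]
      grind
    · refine ⟨⟨i, by lia⟩, 1, a ⟨i + 1, by lia⟩, fun v => funext fun ⟨k, hk⟩ => ?_⟩
      simp only [cyclicFace, Function.update_apply, Fin.ext_iff, Fin.val_zero, Fin.castSucc_mk, Fin.succ_mk, Fin.last, h0]
      grind
    · by_cases h' : m = i + 1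
      · refine ⟨⟨i, by lia⟩, a ⟨i, by lia⟩, 1, fun v => funext fun ⟨k, hk⟩ => ?_⟩
        simp only [cyclicFace, Function.update_apply, Fin.ext_iff, Fin.val_zero, Fin.castSucc_mk, Fin.succ_mk, Fin.last, h0]
        grind
      · refine ⟨⟨m - 1, by lia⟩, 1, 1, fun v => funext fun ⟨k, hk⟩ => ?_⟩
        simp only [cyclicFace, Function.update_apply, Fin.ext_iff, Fin.val_zero, Fin.castSucc_mk, Fin.succ_mk, Fin.last, h0]
        grind

theorem prod_cyclicFace_of_ne {G : Type*} [Group G] {n : ℕ} {i : Fin (n + 2)}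
    (hl : i ≠ Fin.last (n + 1)) (g : Fin (n + 2) → G) :
    (List.ofFn (cyclicFace i g)).prod = (List.ofFn g).prod := by
  have e : cyclicFace i g = Fin.contractNth i (· * ·) g := by
    funext k
    simp [cyclicFace, hl, Fin.contractNth]
  have key := congrFun (Fin.partialProd_contractNth g i) (Fin.last _)
  have h : i.succ.succAbove (Fin.last (n+1)) = Fin.last (n+2) := by
    exact Fin.succAbove_ne_last_last (by simpa using hl)
  simp only [Function.comp, h] at key
  simp only [Fin.partialProd, Fin.val_last] at key
  rw [List.take_of_length_le (by simp), List.take_of_length_le (by simp)] at key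
  rw [e, key]

theorem prod_cyclicFace_last {G : Type*} [Group G] {n : ℕ} (g : Fin (n + 2) → G) :
    (List.ofFn (cyclicFace (Fin.last (n + 1)) g)).prod =
      g (Fin.last (n + 1)) * (List.ofFn g).prod * (g (Fin.last (n + 1)))⁻¹ := by
  have e : List.ofFn (cyclicFace (Fin.last (n + 1)) g) =
      (g (Fin.last _) * g 0) :: List.ofFn (fun k : Fin n => g k.succ.castSucc) := by
    rw [List.ofFn_succ]
    simp [cyclicFace]
  have e' : (List.ofFn g).prod =
      g 0 * ((List.ofFn (fun k : Fin n => g k.succ.castSucc)).prod * g (Fin.last _)) := by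
    rw [List.ofFn_succ, List.prod_cons, List.ofFn_succ', List.concat_eq_append, List.prod_append]
    simp
  rw [e, e', List.prod_cons]
  group

theorem prod_cyclicFace {G : Type*} [Group G] {n : ℕ} (i : Fin (n + 2)) (g : Fin (n + 2) → G) :
    IsConj (List.ofFn (cyclicFace i g)).prod (List.ofFn g).prod := by
  by_cases hl : i = Fin.last (n + 1)
  · rw [hl, prod_cyclicFace_last, isConj_comm, isConj_iff]
    exact ⟨g (Fin.last _), rfl⟩
  · rw [prod_cyclicFace_of_ne hl]


/-! ### Cochain complexes of continuous duals -/

/-- Precomposition with a continuous linear map, on continuous duals. -/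
def dualMap {V W : Type u} [NormedAddCommGroup V] [NormedSpace ℂ V]
    [NormedAddCommGroup W] [NormedSpace ℂ W] (b : V →L[ℂ] W) :
    ModuleCat.of ℂ (W →L[ℂ] ℂ) ⟶ ModuleCat.of ℂ (V →L[ℂ] ℂ) :=
  ModuleCat.ofHom
    { toFun := fun φ => φ.comp b
      map_add' := fun _ _ => rfl
      map_smul' := fun _ _ => rfl }

/-- The cochain complex of continuous linear functionals on a chain complex
`V₀ ← V₁ ← V₂ ← ⋯` of normed spaces and continuous linear maps. -/
def dualComplex (V : ℕ → Type u) [∀ n, NormedAddCommGroup (V n)] [∀ n, NormedSpace ℂ (V n)]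
    (b : ∀ n, V (n + 1) →L[ℂ] V n) (hb : ∀ n, (b n).comp (b (n + 1)) = 0) :
    CochainComplex (ModuleCat.{u} ℂ) ℕ :=
  CochainComplex.of (fun n => ModuleCat.of ℂ (V n →L[ℂ] ℂ)) (fun n => dualMap (b n)) (by
    intro n
    ext φ : 2
    change (φ.comp (b n)).comp (b (n + 1)) = 0
    rw [ContinuousLinearMap.comp_assoc, hb, ContinuousLinearMap.comp_zero])

/-- The cochain map between complexes of continuous functionals induced by a continuous chain
map. -/
def dualComplexMap {V W : ℕ → Type u}
    [∀ n, NormedAddCommGroup (V n)] [∀ n, NormedSpace ℂ (V n)]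
    [∀ n, NormedAddCommGroup (W n)] [∀ n, NormedSpace ℂ (W n)]
    {b : ∀ n, V (n + 1) →L[ℂ] V n} {hb : ∀ n, (b n).comp (b (n + 1)) = 0}
    {c : ∀ n, W (n + 1) →L[ℂ] W n} {hc : ∀ n, (c n).comp (c (n + 1)) = 0}
    (t : ∀ n, V n →L[ℂ] W n) (ht : ∀ n, (c n).comp (t (n + 1)) = (t n).comp (b n)) :
    dualComplex W c hc ⟶ dualComplex V b hb :=
  CochainComplex.ofHom (fun n => dualMap (t n)) (by
    intro n
    simp only [dualComplex, CochainComplex.of_d]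
    ext φ : 2
    change (φ.comp (t n)).comp (b n) = (φ.comp (c n)).comp (t (n + 1))
    rw [ContinuousLinearMap.comp_assoc, ContinuousLinearMap.comp_assoc, ht])

/-! ### The topological Hochschild complex of a normed algebra -/

section Hochschild

variable {A B : Type u} [NormedRing A] [NormedAlgebra ℂ A] [NormedRing B] [NormedAlgebra ℂ B]

variable (A) in
/-- The completed projective tensor power `A ⊗̂ ⋯ ⊗̂ A` with `n` factors. -/
abbrev TensorPow (n : ℕ) : Type u := UniformSpace.Completion (⨂[ℂ] _ : Fin n, A)

/-- The elementary tensor `a₁ ⊗ ⋯ ⊗ aₙ` in the completed projective tensor power. -/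
def elem {n : ℕ} : ContinuousMultilinearMap ℂ (fun _ : Fin n => A) (TensorPow A n) :=
  (UniformSpace.Completion.toComplL (𝕜 := ℂ)).compContinuousMultilinearMap
    (PiTensorProduct.tprodL ℂ)

/-- The continuous linear map on the completed projective tensor power that corresponds to a
continuous multilinear map. -/
def tensorLift {n : ℕ} {F : Type*} [NormedAddCommGroup F] [NormedSpace ℂ F] [CompleteSpace F]
    (f : ContinuousMultilinearMap ℂ (fun _ : Fin n => A) F) : TensorPow A n →L[ℂ] F :=
  (PiTensorProduct.liftIsometry ℂ (fun _ : Fin n => A) F f).fromCompletion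

theorem tensorLift_elem {n : ℕ} {F : Type*} [NormedAddCommGroup F] [NormedSpace ℂ F]
    [CompleteSpace F] (f : ContinuousMultilinearMap ℂ (fun _ : Fin n => A) F) (a : Fin n → A) :
    tensorLift f (elem a) = f a := by
  simp [tensorLift, elem]

theorem tensor_ext {n : ℕ} {F : Type*} [NormedAddCommGroup F] [NormedSpace ℂ F]
    {φ ψ : TensorPow A n →L[ℂ] F} (h : ∀ a : Fin n → A, φ (elem a) = ψ (elem a)) : φ = ψ := by
  have key : φ.comp (UniformSpace.Completion.toComplL (𝕜 := ℂ)) =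
      ψ.comp (UniformSpace.Completion.toComplL (𝕜 := ℂ)) := by
    apply ContinuousLinearMap.coe_injective
    ext a
    simpa [elem] using h a
  ext x
  induction x using UniformSpace.Completion.induction_on with
  | hp => exact isClosed_eq φ.continuous ψ.continuous
  | ih x => exact DFunLike.congr_fun key x

theorem continuous_cyclicFace {A : Type*} [NormedRing A] {n : ℕ} (i : Fin (n + 2)) :
    Continuous (fun a : Fin (n + 2) → A => cyclicFace i a) := by
  refine continuous_pi fun k => ?_
  simp only [cyclicFace]
  split_ifs <;> fun_prop

/-- The `i`-th face `A ⊗̂ ⋯ ⊗̂ A → A ⊗̂ ⋯ ⊗̂ A` of the topological Hochschild complex. -/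
def hochschildFace {n : ℕ} (i : Fin (n + 2)) : TensorPow A (n + 2) →L[ℂ] TensorPow A (n + 1) :=
  tensorLift
    { toFun := fun a => elem (cyclicFace i a)
      map_update_add' := by
        intro _ a m x y
        obtain rfl := Subsingleton.elim ‹DecidableEq (Fin (n + 2))› (instDecidableEqFin (n + 2))
        obtain ⟨p, l, r, h⟩ := exists_cyclicFace_update i a m
        simp only [h, mul_add, add_mul, ContinuousMultilinearMap.map_update_add]
      map_update_smul' := by
        intro _ a m c x
        obtain rfl := Subsingleton.elim ‹DecidableEq (Fin (n + 2))› (instDecidableEqFin (n + 2))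
        obtain ⟨p, l, r, h⟩ := exists_cyclicFace_update i a m
        simp only [h, mul_smul_comm, smul_mul_assoc, ContinuousMultilinearMap.map_update_smul]
      cont := elem.cont.comp (continuous_cyclicFace i) }

theorem hochschildFace_elem {n : ℕ} (i : Fin (n + 2)) (a : Fin (n + 2) → A) :
    hochschildFace i (elem a) = elem (cyclicFace i a) := by
  rw [hochschildFace, tensorLift_elem]
  rfl

variable (A) in
/-- The Hochschild boundary `b = ∑ᵢ (-1)ⁱ ∂ᵢ`. -/
def hochschildB (n : ℕ) : TensorPow A (n + 2) →L[ℂ] TensorPow A (n + 1) :=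
  ∑ i : Fin (n + 2), (-1 : ℂ) ^ (i : ℕ) • hochschildFace i

theorem hochschildB_elem {n : ℕ} (a : Fin (n + 2) → A) :
    hochschildB A n (elem a) =
      ∑ i : Fin (n + 2), (-1 : ℂ) ^ (i : ℕ) • elem (cyclicFace i a) := by
  simp [hochschildB, hochschildFace_elem]

variable (A) in
theorem hochschildB_comp (n : ℕ) : (hochschildB A n).comp (hochschildB A (n + 1)) = 0 := by
  apply tensor_ext
  intro a
  simp only [ContinuousLinearMap.comp_apply, hochschildB_elem, map_sum, map_smul]
  have := alternating_sum_eq_zero (M := TensorPow A (n + 1))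
    (fun (i : Fin (n + 2)) (j : Fin (n + 3)) => elem (cyclicFace i (cyclicFace j a)))
    (fun i j hij => by simp only [cyclicFace_cyclicFace i j hij])
  simp only [Finset.smul_sum] at this ⊢
  rw [Finset.sum_comm] at this
  rw [zero_apply, ← this]
  exact Finset.sum_congr rfl fun i _ => Finset.sum_congr rfl fun j _ => smul_comm _ _ _

variable (A) in
/-- The topological Hochschild cochain complex of `A`: continuous functionals on the complex
`A ← A ⊗̂ A ← A ⊗̂ A ⊗̂ A ← ⋯`. -/
def hochschildCochains : CochainComplex (ModuleCat.{u} ℂ) ℕ :=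
  dualComplex (fun n => TensorPow A (n + 1)) (hochschildB A) (hochschildB_comp A)

variable (A) in
/-- The topological Hochschild cohomology `HHⁿ_t(A)`. -/
abbrev HHt (n : ℕ) : ModuleCat.{u} ℂ := (hochschildCochains A).homology n

/-- The map on completed projective tensor powers induced by a continuous linear map. -/
def tensorMap (f : A →L[ℂ] B) (n : ℕ) : TensorPow A n →L[ℂ] TensorPow B n :=
  (PiTensorProduct.mapL fun _ : Fin n => f).completion

theorem tensorMap_elem (f : A →L[ℂ] B) {n : ℕ} (a : Fin n → A) :
    tensorMap f n (elem a) = elem (fun k => f (a k)) := by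
  simp [tensorMap, elem]

theorem hochschildB_tensorMap (f : A →L[ℂ] B) (hf : ∀ a b, f (a * b) = f a * f b) (n : ℕ) :
    (hochschildB B n).comp (tensorMap f (n + 2)) = (tensorMap f (n + 1)).comp (hochschildB A n) := by
  apply tensor_ext
  intro a
  simp only [ContinuousLinearMap.comp_apply, tensorMap_elem, hochschildB_elem, map_sum, map_smul,
    map_cyclicFace f hf]

end Hochschild

/-! ### The Banach algebra `ℓ¹(G)` -/

/-- The Banach space `ℓ¹(G)` of absolutely summable functions `a : G → ℂ`, with the norm
`∑ g, ‖a g‖`. -/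
def EllOne (G : Type u) : Type u := lp (fun _ : G => ℂ) 1

section EllOne

variable {G : Type u}

instance : NormedAddCommGroup (EllOne G) :=
  inferInstanceAs (NormedAddCommGroup (lp (fun _ : G => ℂ) 1))

instance : NormedSpace ℂ (EllOne G) := inferInstanceAs (NormedSpace ℂ (lp (fun _ : G => ℂ) 1))

instance : CompleteSpace (EllOne G) := inferInstanceAs (CompleteSpace (lp (fun _ : G => ℂ) 1))

open Classical in
/-- The point mass at `g`. -/
def delta (g : G) : EllOne G := lp.single 1 g (1 : ℂ)

theorem norm_delta (g : G) : ‖delta g‖ = 1 := by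
  classical
  have h := lp.norm_single (E := fun _ : G => ℂ) one_pos g (1 : ℂ)
  rw [norm_one] at h
  exact h

theorem summable_norm (a : EllOne G) : Summable (fun g => ‖a.1 g‖) := by
  have h := (lp.memℓp a).summable (by simp)
  simp only [ENNReal.toReal_one, Real.rpow_one] at h
  exact h

theorem norm_eq_tsum (a : EllOne G) : ‖a‖ = ∑' g, ‖a.1 g‖ := by
  have h := lp.norm_eq_tsum_rpow (p := 1) (by simp) a
  simp only [ENNReal.toReal_one, Real.rpow_one, div_one] at h
  exact h

theorem delta_ext {F : Type*} [NormedAddCommGroup F] [NormedSpace ℂ F] {φ ψ : EllOne G →L[ℂ] F}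
    (h : ∀ g, φ (delta g) = ψ (delta g)) : φ = ψ := by
  classical
  refine lp.ext_continuousLinearMap (E := fun _ : G => ℂ) ENNReal.one_ne_top fun g => ?_
  refine ContinuousLinearMap.ext_ring ?_
  exact h g

theorem summable_smul {F : Type*} [NormedAddCommGroup F] [NormedSpace ℂ F] [CompleteSpace F]
    {u : G → F} {C : ℝ} (hu : ∀ g, ‖u g‖ ≤ C) (a : EllOne G) :
    Summable (fun g => a.1 g • u g) := by
  refine Summable.of_norm_bounded ((summable_norm a).mul_right C) fun g => ?_
  rw [norm_smul]
  exact mul_le_mul_of_nonneg_left (hu g) (norm_nonneg _)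

/-- The continuous linear map `a ↦ ∑ g, a g • u g` on `ℓ¹(G)` given by a bounded family `u`. -/
def ellOneLift {F : Type*} [NormedAddCommGroup F] [NormedSpace ℂ F] [CompleteSpace F]
    (u : G → F) (C : ℝ) (hu : ∀ g, ‖u g‖ ≤ C) : EllOne G →L[ℂ] F :=
  LinearMap.mkContinuous
    { toFun := fun a => ∑' g, a.1 g • u g
      map_add' := by
        intro a b
        rw [← (summable_smul hu a).tsum_add (summable_smul hu b)]
        exact tsum_congr fun g => add_smul _ _ _
      map_smul' := by
        intro c a
        rw [RingHom.id_apply, ← (summable_smul hu a).tsum_const_smul c]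
        exact tsum_congr fun g => mul_smul _ _ _ } C (by
    intro a
    rw [norm_eq_tsum, mul_comm, ← tsum_mul_right]
    refine tsum_of_norm_bounded ((summable_norm a).mul_right C).hasSum fun g => ?_
    rw [norm_smul]
    exact mul_le_mul_of_nonneg_left (hu g) (norm_nonneg _))

theorem ellOneLift_delta {F : Type*} [NormedAddCommGroup F] [NormedSpace ℂ F] [CompleteSpace F]
    (u : G → F) (C : ℝ) (hu : ∀ g, ‖u g‖ ≤ C) (g : G) : ellOneLift u C hu (delta g) = u g := by
  classical
  change ∑' g', (delta g).1 g' • u g' = u g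
  rw [tsum_eq_single g]
  · have : (delta g).1 g = 1 := lp.single_apply_self (E := fun _ : G => ℂ) 1 g 1
    rw [this, one_smul]
  · intro g' hg'
    have : (delta g).1 g' = 0 := lp.single_apply_ne (E := fun _ : G => ℂ) 1 g 1 hg'
    rw [this, zero_smul]

theorem norm_ellOneLift_le {F : Type*} [NormedAddCommGroup F] [NormedSpace ℂ F] [CompleteSpace F]
    (u : G → F) (C : ℝ) (hC : 0 ≤ C) (hu : ∀ g, ‖u g‖ ≤ C) : ‖ellOneLift u C hu‖ ≤ C :=
  LinearMap.mkContinuous_norm_le _ hC _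

variable [Group G]

/-- Convolution on `ℓ¹(G)`: `(a, b) ↦ ∑ g, ∑ g', a g • b g' • δ_{g g'}`. -/
def convolution : EllOne G →L[ℂ] EllOne G →L[ℂ] EllOne G :=
  ellOneLift (fun g => ellOneLift (fun g' => delta (g * g')) 1 fun _ => (norm_delta _).le) 1
    fun _ => norm_ellOneLift_le _ 1 zero_le_one _

theorem convolution_delta (g g' : G) :
    convolution (delta g) (delta g') = delta (g * g') := by
  rw [convolution, ellOneLift_delta, ellOneLift_delta]

theorem convolution_assoc (a b c : EllOne G) :
    convolution (convolution a b) c = convolution a (convolution b c) := by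
  let L := ContinuousLinearMap.compL ℂ (EllOne G) (EllOne G) (EllOne G)
  have h : (ContinuousLinearMap.compL ℂ (EllOne G) (EllOne G) (EllOne G →L[ℂ] EllOne G)
        (convolution (G := G))).comp convolution =
      ((ContinuousLinearMap.compL ℂ (EllOne G) (EllOne G →L[ℂ] EllOne G)
        (EllOne G →L[ℂ] EllOne G)).flip convolution).comp (L.comp convolution) := by
    refine delta_ext fun g₁ => delta_ext fun g₂ => delta_ext fun g₃ => ?_
    simp [L, convolution_delta, mul_assoc]
  exact congrArg (fun f => f a b c) h

theorem one_convolution (a : EllOne G) : convolution (delta 1) a = a := by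
  have h : convolution (delta (1 : G)) = ContinuousLinearMap.id ℂ (EllOne G) :=
    delta_ext fun g => by simp [convolution_delta]
  rw [h, ContinuousLinearMap.id_apply]

theorem convolution_one (a : EllOne G) : convolution a (delta 1) = a := by
  have h : convolution.flip (delta (1 : G)) = ContinuousLinearMap.id ℂ (EllOne G) :=
    delta_ext fun g => by simp [convolution_delta]
  exact congrArg (fun f => f a) h

theorem norm_convolution_le (a b : EllOne G) : ‖convolution a b‖ ≤ ‖a‖ * ‖b‖ := by
  refine ((convolution a).le_opNorm b).trans
    (mul_le_mul_of_nonneg_right ?_ (norm_nonneg b))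
  refine (convolution.le_opNorm a).trans ?_
  exact mul_le_of_le_one_left (norm_nonneg a) (norm_ellOneLift_le _ 1 zero_le_one _)

/-- `ℓ¹(G)` is a Banach algebra under convolution, with unit `δ₁`. -/
instance : NormedRing (EllOne G) :=
  { (inferInstance : NormedAddCommGroup (EllOne G)) with
    mul := fun a b => convolution a b
    one := delta 1
    mul_assoc := convolution_assoc
    one_mul := one_convolution
    mul_one := convolution_one
    left_distrib := fun a b c => map_add (convolution a) b c
    right_distrib := fun a b c => congrArg (fun f => f c) (map_add convolution a b)
    zero_mul := fun a => congrArg (fun f => f a) (map_zero convolution)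
    mul_zero := fun a => map_zero (convolution a)
    norm_mul_le := norm_convolution_le }

instance : NormedAlgebra ℂ (EllOne G) :=
  { Algebra.ofModule (R := ℂ) (A := EllOne G)
      (fun c a b => congrArg (fun f => f b) (map_smul convolution c a))
      (fun c a b => map_smul (convolution a) c b) with
    norm_smul_le := norm_smul_le }

theorem delta_mul_delta (g g' : G) : delta g * delta g' = delta (g * g') :=
  convolution_delta g g'

variable {H : Type u} [Group H]

/-- The homomorphism `ℓ¹(G) → ℓ¹(H)`, `δ_g ↦ δ_{f g}`, induced by a group homomorphism `f`. -/
def ellOneMap (f : G →* H) : EllOne G →L[ℂ] EllOne H :=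
  ellOneLift (fun g => delta (f g)) 1 fun _ => (norm_delta _).le

theorem ellOneMap_delta (f : G →* H) (g : G) : ellOneMap f (delta g) = delta (f g) :=
  ellOneLift_delta _ _ _ _

theorem ellOneMap_mul (f : G →* H) (a b : EllOne G) :
    ellOneMap f (a * b) = ellOneMap f a * ellOneMap f b := by
  have h : (ContinuousLinearMap.compL ℂ (EllOne G) (EllOne G) (EllOne H) (ellOneMap f)).comp
        convolution =
      ((ContinuousLinearMap.compL ℂ (EllOne G) (EllOne H) (EllOne H)).flip (ellOneMap f)).comp
        (convolution.comp (ellOneMap f)) := by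
    refine delta_ext fun g₁ => delta_ext fun g₂ => ?_
    simp [convolution_delta, ellOneMap_delta]
  exact congrArg (fun f => f a b) h

end EllOne

/-! ### The summand at a conjugacy class -/

section Summand

variable {G H : Type u} [Group G] [Group H]

/-- The part of `ℓ¹(G) ⊗̂ ⋯ ⊗̂ ℓ¹(G)` at the conjugacy class `x`: the closed linear span of the
elementary tensors `δ_{g₁} ⊗ ⋯ ⊗ δ_{gₙ}` with `g₁ ⋯ gₙ ∈ x`. -/
def classPart (x : ConjClasses G) (n : ℕ) : Submodule ℂ (TensorPow (EllOne G) n) :=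
  (Submodule.span ℂ {t | ∃ g : Fin n → G, ConjClasses.mk (List.ofFn g).prod = x ∧
    t = elem fun k => delta (g k)}).topologicalClosure

theorem elem_mem_classPart {n : ℕ} (g : Fin n → G) :
    elem (fun k => delta (g k)) ∈ classPart (ConjClasses.mk (List.ofFn g).prod) n :=
  Submodule.le_topologicalClosure _ (Submodule.subset_span ⟨g, rfl, rfl⟩)

theorem map_mem_of_mem_classPart {x : ConjClasses G} {n : ℕ} {F : Type*} [NormedAddCommGroup F]
    [NormedSpace ℂ F] {f : TensorPow (EllOne G) n →L[ℂ] F} {p : Submodule ℂ F}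
    (hp : IsClosed (p : Set F))
    (h : ∀ g : Fin n → G, ConjClasses.mk (List.ofFn g).prod = x →
      f (elem fun k => delta (g k)) ∈ p)
    {t : TensorPow (EllOne G) n} (ht : t ∈ classPart x n) : f t ∈ p := by
  have hle : classPart x n ≤ p.comap (f : TensorPow (EllOne G) n →ₗ[ℂ] F) := by
    refine Submodule.topologicalClosure_minimal _ (Submodule.span_le.2 ?_) ?_
    · rintro _ ⟨g, hg, rfl⟩
      exact h g hg
    · exact hp.preimage f.continuous
  exact hle ht

theorem isClosed_classPart (x : ConjClasses G) (n : ℕ) :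
    IsClosed (classPart x n : Set (TensorPow (EllOne G) n)) :=
  Submodule.isClosed_topologicalClosure _

theorem hochschildB_mem_classPart (x : ConjClasses G) (n : ℕ) (t : TensorPow (EllOne G) (n + 2))
    (ht : t ∈ classPart x (n + 2)) : hochschildB (EllOne G) n t ∈ classPart x (n + 1) := by
  refine map_mem_of_mem_classPart (isClosed_classPart x (n + 1)) (fun g hg => ?_) ht
  rw [hochschildB_elem]
  refine Submodule.sum_mem _ fun i _ => Submodule.smul_mem _ _ ?_
  rw [← map_cyclicFace (delta (G := G)) (fun a b => (delta_mul_delta a b).symm) i g, ← hg,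
    ← ConjClasses.mk_eq_mk_iff_isConj.2 (prod_cyclicFace i g)]
  exact elem_mem_classPart (cyclicFace i g)

theorem tensorMap_mem_classPart (f : G →* H) {x : ConjClasses G} {y : ConjClasses H}
    (hxy : x.map f = y) (n : ℕ) (t : TensorPow (EllOne G) n) (ht : t ∈ classPart x n) :
    tensorMap (ellOneMap f) n t ∈ classPart y n := by
  refine map_mem_of_mem_classPart (isClosed_classPart y n) (fun g hg => ?_) ht
  have h : ConjClasses.mk (List.ofFn fun k => f (g k)).prod = y := by
    rw [← hxy, ← hg]
    change _ = ConjClasses.mk (f (List.ofFn g).prod)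
    rw [map_list_prod, List.map_ofFn]
    rfl
  rw [tensorMap_elem, ← h]
  simp only [ellOneMap_delta]
  exact elem_mem_classPart fun k => f (g k)

/-- The Hochschild boundary on the part of the complex at `x`. -/
def classB (x : ConjClasses G) (n : ℕ) : classPart x (n + 2) →L[ℂ] classPart x (n + 1) :=
  ((hochschildB (EllOne G) n).comp (classPart x (n + 2)).subtypeL).codRestrict _
    fun t => hochschildB_mem_classPart x n t t.2

theorem classB_comp (x : ConjClasses G) (n : ℕ) : (classB x n).comp (classB x (n + 1)) = 0 := by
  ext t : 2
  exact DFunLike.congr_fun (hochschildB_comp (EllOne G) n) (t : TensorPow (EllOne G) (n + 3))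

/-- The summand at `x` of the topological Hochschild cochain complex of `ℓ¹(G)`: continuous
functionals on the part of the Hochschild complex at `x`. -/
def classCochains (x : ConjClasses G) : CochainComplex (ModuleCat.{u} ℂ) ℕ :=
  dualComplex (fun n => classPart x (n + 1)) (classB x) (classB_comp x)

/-- The summand `HHⁿ_t(ℓ¹(G))_x` of the topological Hochschild cohomology of `ℓ¹(G)`. -/
abbrev HHtClass (x : ConjClasses G) (n : ℕ) : ModuleCat.{u} ℂ := (classCochains x).homology n

/-- Restriction of functionals to the part at `x`, on Hochschild cochains. -/
def toClassCochains (x : ConjClasses G) : hochschildCochains (EllOne G) ⟶ classCochains x :=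
  dualComplexMap (fun n => (classPart x (n + 1)).subtypeL) fun _ => rfl

/-- The component at `x`, `HHⁿ_t(ℓ¹(G)) → HHⁿ_t(ℓ¹(G))_x`. -/
abbrev toHHtClass (x : ConjClasses G) (n : ℕ) : HHt (EllOne G) n ⟶ HHtClass x n :=
  HomologicalComplex.homologyMap (toClassCochains x) n

/-- The cochain map induced on summands by a homomorphism `f` that maps the class `x` to `y`. -/
def classCochainsMap (f : G →* H) {x : ConjClasses G} {y : ConjClasses H} (hxy : x.map f = y) :
    classCochains y ⟶ classCochains x :=
  dualComplexMap
    (fun n => ((tensorMap (ellOneMap f) (n + 1)).comp (classPart x (n + 1)).subtypeL).codRestrict _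
      fun t => tensorMap_mem_classPart f hxy (n + 1) t t.2)
    (by
      intro n
      ext t : 2
      exact DFunLike.congr_fun (hochschildB_tensorMap (ellOneMap f) (ellOneMap_mul f) n)
        (t : TensorPow (EllOne G) (n + 2)))

/-- The map `HHⁿ_t(ℓ¹(H))_y → HHⁿ_t(ℓ¹(G))_x` induced by a homomorphism `f : G → H` that maps
the class `x` to `y`. -/
abbrev HHtClassMap (f : G →* H) {x : ConjClasses G} {y : ConjClasses H} (hxy : x.map f = y)
    (n : ℕ) : HHtClass y n ⟶ HHtClass x n :=
  HomologicalComplex.homologyMap (classCochainsMap f hxy) n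

end Summand

/-! ### Bounded cohomology -/

section Bounded

variable {G H : Type u} [Group G] [Group H]

/-- Bounded functions `Gⁿ → ℂ`: the bounded `n`-cochains of `BG`. -/
def boundedFun (G : Type u) (n : ℕ) : Submodule ℂ ((Fin n → G) → ℂ) where
  carrier := {f | ∃ C : ℝ, ∀ g, ‖f g‖ ≤ C}
  zero_mem' := ⟨0, fun _ => by simp⟩
  add_mem' := by
    rintro f₁ f₂ ⟨C₁, h₁⟩ ⟨C₂, h₂⟩
    exact ⟨C₁ + C₂, fun g => (norm_add_le _ _).trans (add_le_add (h₁ g) (h₂ g))⟩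
  smul_mem' := by
    rintro c f ⟨C, h⟩
    refine ⟨‖c‖ * C, fun g => ?_⟩
    rw [Pi.smul_apply, norm_smul]
    exact mul_le_mul_of_nonneg_left (h g) (norm_nonneg c)

theorem comp_mem_boundedFun {G H : Type u} {m n : ℕ} {f : (Fin n → H) → ℂ} (hf : f ∈ boundedFun H n)
    (s : (Fin m → G) → Fin n → H) : (fun g => f (s g)) ∈ boundedFun G m := by
  obtain ⟨C, hC⟩ := hf
  exact ⟨C, fun g => hC (s g)⟩

/-- Composition of bounded functions with a map `Gᵐ → Hⁿ`. -/
def boundedPullback {m n : ℕ} (s : (Fin m → G) → Fin n → H) :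
    boundedFun H n →ₗ[ℂ] boundedFun G m where
  toFun f := ⟨fun g => f.1 (s g), comp_mem_boundedFun f.2 s⟩
  map_add' _ _ := rfl
  map_smul' _ _ := rfl

variable (G) in
/-- The coboundary `∑ᵢ (-1)ⁱ ∂ᵢ*` on bounded cochains of `BG`. -/
def boundedD (n : ℕ) : boundedFun G n →ₗ[ℂ] boundedFun G (n + 1) :=
  ∑ i : Fin (n + 2), (-1 : ℂ) ^ (i : ℕ) • boundedPullback (barFace i)

theorem boundedD_apply (n : ℕ) (f : boundedFun G n) (g : Fin (n + 1) → G) :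
    (boundedD G n f).1 g = ∑ i : Fin (n + 2), (-1 : ℂ) ^ (i : ℕ) • f.1 (barFace i g) := by
  simp [boundedD, boundedPullback]

theorem boundedD_boundedD (n : ℕ) (f : boundedFun G n) :
    boundedD G (n + 1) (boundedD G n f) = 0 := by
  apply Subtype.ext
  funext g
  rw [boundedD_apply]
  simp only [boundedD_apply]
  have := alternating_sum_eq_zero
    (fun (i : Fin (n + 2)) (j : Fin (n + 3)) => f.1 (barFace i (barFace j g)))
    (fun i j hij => by simp only [barFace_barFace i j hij])
  simp only [Finset.smul_sum] at this ⊢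
  rw [Finset.sum_comm] at this
  refine Eq.trans ?_ this
  exact Finset.sum_congr rfl fun i _ => Finset.sum_congr rfl fun j _ => smul_comm _ _ _

variable (G) in
/-- The complex of bounded cochains of `BG` with coefficients in `ℂ`. -/
def boundedCochains : CochainComplex (ModuleCat.{u} ℂ) ℕ :=
  CochainComplex.of (fun n => ModuleCat.of ℂ (boundedFun G n))
    (fun n => ModuleCat.ofHom (boundedD G n)) (by
      intro n
      ext f : 2
      exact boundedD_boundedD n f)

variable (G) in
/-- The bounded cohomology `Hⁿ_b(BG)` with coefficients in `ℂ`. -/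
abbrev boundedCohomology (n : ℕ) : ModuleCat.{u} ℂ := (boundedCochains G).homology n

theorem map_barFace (f : G →* H) {n : ℕ} (i : Fin (n + 2)) (g : Fin (n + 1) → G) :
    (fun k => f (barFace i g k)) = barFace i (fun k => f (g k)) := by
  funext k
  simp only [barFace]
  split_ifs <;> simp

/-- The cochain map `C*_b(BH) → C*_b(BG)` induced by a group homomorphism `f : G → H`. -/
def boundedCochainsMap (f : G →* H) : boundedCochains H ⟶ boundedCochains G :=
  CochainComplex.ofHom
    (fun n => ModuleCat.ofHom (boundedPullback fun (g : Fin n → G) k => f (g k))) (by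
      intro n
      simp only [boundedCochains, CochainComplex.of_d]
      ext φ : 2
      apply Subtype.ext
      funext g
      change (boundedD G n _).1 g = (boundedD H n φ).1 fun k => f (g k)
      rw [boundedD_apply, boundedD_apply]
      simp only [← map_barFace]
      rfl)

/-- The map `Hⁿ_b(BH) → Hⁿ_b(BG)` induced by a group homomorphism `f : G → H`. -/
abbrev boundedCohomologyMap (f : G →* H) (n : ℕ) :
    boundedCohomology H n ⟶ boundedCohomology G n :=
  HomologicalComplex.homologyMap (boundedCochainsMap f) n

end Bounded

/-! ### Centralizers -/

section Centralizer

variable {G H : Type u} [Group G] [Group H]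

/-- The centralizer `G_h` of `h` in `G`. -/
abbrev Cent (h : G) : Subgroup G := Subgroup.centralizer {h}

/-- The homomorphism `G_h → H_{f h}` induced by a group homomorphism `f : G → H`. -/
def centMap (f : G →* H) (h : G) : Cent h →* Cent (f h) :=
  (f.comp (Cent h).subtype).codRestrict (Cent (f h)) fun g => by
    have hg := Subgroup.mem_centralizer_singleton_iff.1 g.2
    rw [Subgroup.mem_centralizer_singleton_iff]
    change f g.1 * f h = f h * f g.1
    rw [← map_mul, ← map_mul, hg]

/-- The inclusion of `B(G_h)` into the part of the cyclic bar construction of `G` at the class of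
`h`: `(g₁, …, gₙ) ↦ ((g₁ ⋯ gₙ)⁻¹ h, g₁, …, gₙ)`. -/
def centSimplex (h : G) {n : ℕ} (g : Fin n → Cent h) : Fin (n + 1) → G :=
  Fin.cons (((List.ofFn g).prod : G)⁻¹ * h) fun k => (g k : G)

theorem prod_centSimplex (h : G) {n : ℕ} (g : Fin n → Cent h) :
    (List.ofFn (centSimplex h g)).prod = h := by
  have hg := Subgroup.mem_centralizer_singleton_iff.1 (List.ofFn g).prod.2
  have e : (List.ofFn fun k => (g k : G)).prod = ((List.ofFn g).prod : G) := by
    have := map_list_prod (Cent h).subtype (List.ofFn g)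
    rw [List.map_ofFn] at this
    exact this.symm
  simp only [centSimplex, List.ofFn_succ, Fin.cons_zero, Fin.cons_succ, List.prod_cons]
  rw [e, mul_assoc, ← hg, inv_mul_cancel_left]

/-- The tensor `δ_{(g₁ ⋯ gₙ)⁻¹ h} ⊗ δ_{g₁} ⊗ ⋯ ⊗ δ_{gₙ}` for `g₁, …, gₙ` in the centralizer of
`h`. -/
def centTensor (h : G) {n : ℕ} (g : Fin n → Cent h) : classPart (ConjClasses.mk h) (n + 1) :=
  ⟨elem fun k => delta (centSimplex h g k), by
    have := elem_mem_classPart (centSimplex h g)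
    rwa [prod_centSimplex] at this⟩

theorem norm_elem_delta_le {n : ℕ} (g : Fin n → G) :
    ‖elem (A := EllOne G) fun k => delta (g k)‖ ≤ 1 := by
  have h := PiTensorProduct.projectiveSeminorm_tprod_le (𝕜 := ℂ) fun k => delta (g k)
  simp only [norm_delta, Finset.prod_const_one] at h
  simpa [elem] using h

theorem cyclicFace_centSimplex (h : G) {n : ℕ} (i : Fin (n + 2)) (g : Fin (n + 1) → Cent h) :
    cyclicFace i (centSimplex h g) = centSimplex h (barFace i g) := by
  have htail : ∀ k : Fin n,
      cyclicFace i (centSimplex h g) k.succ = centSimplex h (barFace i g) k.succ := by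
    intro k
    by_cases hl : i = Fin.last (n + 1)
    · have h1 : (k : ℕ) + 1 < n + 1 := by lia
      simp [cyclicFace, centSimplex, barFace, hl, Fin.castSucc_succ]
    · simp only [cyclicFace, centSimplex, barFace, hl, if_false, Fin.val_succ, Fin.castSucc_succ,
        Fin.cons_succ]
      split_ifs <;> rfl
  have hprod : (List.ofFn (cyclicFace i (centSimplex h g))).prod = h := by
    by_cases hl : i = Fin.last (n + 1)
    · have hc := Subgroup.mem_centralizer_singleton_iff.1 (g (Fin.last n)).2
      have ha : centSimplex h g (Fin.last (n + 1)) = g (Fin.last n) := by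
        rw [← Fin.succ_last, centSimplex, Fin.cons_succ]
      rw [hl, prod_cyclicFace_last, prod_centSimplex, ha, hc, mul_inv_cancel_right]
    · rw [prod_cyclicFace_of_ne hl, prod_centSimplex]
  have h2 := prod_centSimplex h (barFace i g)
  rw [List.ofFn_succ, List.prod_cons] at hprod h2
  simp only [htail] at hprod
  funext k
  refine Fin.cases ?_ htail k
  exact mul_right_cancel (hprod.trans h2.symm)

theorem classB_centTensor (h : G) {n : ℕ} (g : Fin (n + 1) → Cent h) :
    classB (ConjClasses.mk h) n (centTensor h g) =
      ∑ i : Fin (n + 2), (-1 : ℂ) ^ (i : ℕ) • centTensor h (barFace i g) := by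
  apply Subtype.ext
  rw [Submodule.coe_sum]
  refine (hochschildB_elem _).trans (Finset.sum_congr rfl fun i _ => ?_)
  rw [← map_cyclicFace (delta (G := G)) (fun a b => (delta_mul_delta a b).symm) i,
    cyclicFace_centSimplex]
  rfl

/-- Evaluation of functionals on the tensors `δ_{(g₁ ⋯ gₙ)⁻¹ h} ⊗ δ_{g₁} ⊗ ⋯ ⊗ δ_{gₙ}`:
restriction of cochains at the class of `h` to bounded cochains of `B(G_h)`. -/
def centEval (h : G) (n : ℕ) :
    (classPart (ConjClasses.mk h) (n + 1) →L[ℂ] ℂ) →ₗ[ℂ] boundedFun (Cent h) n where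
  toFun φ := ⟨fun g => φ (centTensor h g), ‖φ‖, fun g =>
    (φ.le_opNorm _).trans (mul_le_of_le_one_right (norm_nonneg φ)
      (norm_elem_delta_le (centSimplex h g)))⟩
  map_add' _ _ := rfl
  map_smul' _ _ := rfl

theorem boundedD_centEval (h : G) (n : ℕ) (φ : classPart (ConjClasses.mk h) (n + 1) →L[ℂ] ℂ) :
    boundedD (Cent h) n (centEval h n φ) =
      centEval h (n + 1) (φ.comp (classB (ConjClasses.mk h) n)) := by
  apply Subtype.ext
  funext g
  change _ = φ (classB (ConjClasses.mk h) n (centTensor h g))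
  rw [boundedD_apply, classB_centTensor, map_sum]
  refine Finset.sum_congr rfl fun i _ => ?_
  rw [map_smul]
  rfl

/-- The cochain map induced by the inclusion of `B(G_h)` into the part of the cyclic bar
construction of `G` at the class of `h`. -/
def centRestrict (h : G) : classCochains (ConjClasses.mk h) ⟶ boundedCochains (Cent h) :=
  CochainComplex.ofHom (fun n => ModuleCat.ofHom (centEval h n)) (by
    intro n
    simp only [boundedCochains, classCochains, dualComplex, CochainComplex.of_d]
    ext φ : 2
    exact boundedD_centEval h n φ)

end Centralizer

end

end EllOneHochschild

open CategoryTheory EllOneHochschild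

/-!
Continuous functionals on `ℓ¹(G) ⊗̂ ⋯ ⊗̂ ℓ¹(G)` are the same as bounded functions on `Gⁿ`, by
evaluation on tensors of point masses (`exists_tensor_delta`, `tensor_delta_ext`). The product of the
factors is preserved up to conjugacy by the faces, so extension by zero of functions supported on
one conjugacy class is a cochain map. It is dual to a projection `classProj` onto the part at the
class, and it splits the restriction already on cochains.

For the comparison with bounded cohomology, the simplices of the cyclic bar construction at the
class of `h` are written in homogeneous coordinates: `p ∈ Gⁿ⁺¹` gives the simplex
`(pₙ⁻¹ h p₀, p₀⁻¹ p₁, …, pₙ₋₁⁻¹ pₙ)`, every simplex at the class arises, and `p` is unique up to left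
multiplication by the centralizer `G_h`. Faces become deletions of vertices. Hence cochains at the
class are bounded `G_h`-invariant functions on `Gⁿ⁺¹` (`vertexEquiv`), and restriction to `B(G_h)`
restricts such a function to vertices in `G_h`. A `G_h`-equivariant retraction `ρ : G → G_h` gives
the extension `centExtend` in the other direction. Restriction after extension is the identity;
extension after restriction is composition with `ρ`, which is homotopic to the identity through the
operator `prism`: a finite combination of simplices, natural for left multiplication by `G_h`, so it
preserves both boundedness and invariance. Restriction is therefore a homotopy equivalence of
cochain complexes (`centHomotopyEquiv`), and naturality holds on cochains.
-/

namespace EllOneHochschild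

noncomputable section

/-! ### Functionals on tensor powers of `ℓ¹(G)` and bounded functions -/

section BoundedExtension

variable {G : Type u} [Group G]

theorem exists_multilinear_delta {F : Type*} [NormedAddCommGroup F] [NormedSpace ℂ F]
    [CompleteSpace F] {C : ℝ} (hC : 0 ≤ C) {n : ℕ} (u : (Fin n → G) → F) (hu : ∀ g, ‖u g‖ ≤ C) :
    ∃ L : ContinuousMultilinearMap ℂ (fun _ : Fin n => EllOne G) F,
      ‖L‖ ≤ C ∧ ∀ g, L (fun k => delta (g k)) = u g := by
  induction n with
  | zero =>
    refine ⟨ContinuousMultilinearMap.constOfIsEmpty ℂ _ (u default), ?_, fun g => ?_⟩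
    · rw [ContinuousMultilinearMap.norm_constOfIsEmpty]
      exact hu _
    · rw [Subsingleton.elim g default]
      rfl
  | succ n ih =>
    choose L hL hLu using fun g : G =>
      ih (fun g' => u (Fin.cons (α := fun _ => G) g g')) fun _ => hu _
    refine ⟨(ellOneLift L C hL).uncurryLeft, ?_, fun g => ?_⟩
    · rw [ContinuousLinearMap.uncurryLeft_norm]
      exact norm_ellOneLift_le L C hC hL
    · rw [ContinuousLinearMap.uncurryLeft_apply, ellOneLift_delta]
      refine (hLu (g 0) (Fin.tail g)).trans ?_
      rw [Fin.cons_self_tail]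

theorem multilinear_delta_ext {F : Type*} [NormedAddCommGroup F] [NormedSpace ℂ F] {n : ℕ}
    {L M : ContinuousMultilinearMap ℂ (fun _ : Fin n => EllOne G) F}
    (h : ∀ g : Fin n → G, L (fun k => delta (g k)) = M fun k => delta (g k)) : L = M := by
  induction n with
  | zero =>
    ext a
    rw [Subsingleton.elim a fun k => delta (Fin.elim0 k : G)]
    exact h _
  | succ n ih =>
    have hc : L.curryLeft = M.curryLeft := by
      refine delta_ext fun g => ih fun g' => ?_
      have e : (Fin.cons (delta g) fun k => delta (g' k) : Fin (n + 1) → EllOne G) =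
          fun k => delta (Fin.cons (α := fun _ => G) g g' k) := by
        funext k
        refine Fin.cases ?_ (fun k => ?_) k <;> simp
      rw [ContinuousMultilinearMap.curryLeft_apply, ContinuousMultilinearMap.curryLeft_apply]
      exact (congrArg L e).trans ((h _).trans (congrArg M e).symm)
    rw [← L.uncurry_curryLeft, hc, M.uncurry_curryLeft]

/-- Continuous linear maps on the tensor powers of `ℓ¹(G)` are determined by their values on the
tensors of point masses. -/
theorem tensor_delta_ext {F : Type*} [NormedAddCommGroup F] [NormedSpace ℂ F] [CompleteSpace F]
    {n : ℕ} {φ ψ : TensorPow (EllOne G) n →L[ℂ] F}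
    (h : ∀ g : Fin n → G, φ (elem fun k => delta (g k)) = ψ (elem fun k => delta (g k))) :
    φ = ψ := by
  have hm : φ.compContinuousMultilinearMap elem = ψ.compContinuousMultilinearMap elem :=
    multilinear_delta_ext h
  exact tensor_ext fun a => DFunLike.congr_fun hm a

/-- The universal property of the tensor powers of `ℓ¹(G)`: a bounded function on `Gⁿ` extends to
a continuous linear map on the `n`-th tensor power. -/
theorem exists_tensor_delta {F : Type*} [NormedAddCommGroup F] [NormedSpace ℂ F]
    [CompleteSpace F] {n : ℕ} {u : (Fin n → G) → F} (hu : ∃ C : ℝ, ∀ g, ‖u g‖ ≤ C) :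
    ∃ φ : TensorPow (EllOne G) n →L[ℂ] F, ∀ g, φ (elem fun k => delta (g k)) = u g := by
  obtain ⟨C, hC⟩ := hu
  obtain ⟨L, -, hL⟩ := exists_multilinear_delta ((norm_nonneg _).trans (hC fun _ => 1)) u hC
  exact ⟨tensorLift L, fun g => (tensorLift_elem L _).trans (hL g)⟩

end BoundedExtension

/-! ### The projections onto the conjugacy classes -/

section Projection

variable {G : Type u} [Group G]

instance (x : ConjClasses G) (n : ℕ) : CompleteSpace (classPart x n) :=
  (isClosed_classPart x n).completeSpace_coe

/-- The tensor `δ_{g₁} ⊗ ⋯ ⊗ δ_{gₙ}` in the part at the class of `g₁ ⋯ gₙ`. -/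
def classElem {x : ConjClasses G} {n : ℕ} (g : Fin n → G)
    (hg : ConjClasses.mk (List.ofFn g).prod = x) : classPart x n :=
  ⟨elem fun k => delta (g k), hg ▸ elem_mem_classPart g⟩

theorem norm_classElem_le {x : ConjClasses G} {n : ℕ} (g : Fin n → G)
    (hg : ConjClasses.mk (List.ofFn g).prod = x) : ‖classElem g hg‖ ≤ 1 :=
  norm_elem_delta_le g

theorem classPart_ext {x : ConjClasses G} {n : ℕ} {F : Type*} [NormedAddCommGroup F]
    [NormedSpace ℂ F] {φ ψ : classPart x n →L[ℂ] F}
    (h : ∀ g hg, φ (classElem g hg) = ψ (classElem g hg)) : φ = ψ := by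
  let s : Set (TensorPow (EllOne G) n) := {t | ∃ g : Fin n → G,
    ConjClasses.mk (List.ofFn g).prod = x ∧ t = elem fun k => delta (g k)}
  have key : ∀ t (ht : t ∈ Submodule.span ℂ s) (ht' : t ∈ classPart x n),
      φ ⟨t, ht'⟩ = ψ ⟨t, ht'⟩ := by
    intro t ht
    induction ht using Submodule.span_induction with
    | mem t ht =>
      obtain ⟨g, hg, rfl⟩ := ht
      exact fun _ => h g hg
    | zero => exact fun ht' => (map_zero φ).trans (map_zero ψ).symm
    | add a b ha hb iha ihb =>
      intro _
      have ha' := Submodule.le_topologicalClosure _ ha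
      have hb' := Submodule.le_topologicalClosure _ hb
      exact (map_add φ ⟨a, ha'⟩ ⟨b, hb'⟩).trans
        ((congrArg₂ (· + ·) (iha ha') (ihb hb')).trans (map_add ψ ⟨a, ha'⟩ ⟨b, hb'⟩).symm)
    | smul c a ha iha =>
      intro _
      have ha' := Submodule.le_topologicalClosure _ ha
      exact (map_smul φ c ⟨a, ha'⟩).trans
        ((congrArg (c • ·) (iha ha')).trans (map_smul ψ c ⟨a, ha'⟩).symm)
  have hd : Dense {t : classPart x n | (t : TensorPow (EllOne G) n) ∈ Submodule.span ℂ s} := by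
    rw [Subtype.dense_iff]
    intro t ht
    have : (Subtype.val '' {t : classPart x n |
        (t : TensorPow (EllOne G) n) ∈ Submodule.span ℂ s}) = Submodule.span ℂ s := by
      ext t
      refine ⟨?_, fun ht => ⟨⟨t, Submodule.le_topologicalClosure _ ht⟩, ht, rfl⟩⟩
      rintro ⟨t, ht, rfl⟩
      exact ht
    exact (congrArg closure this).ge ht
  exact DFunLike.coe_injective (Continuous.ext_on hd φ.continuous ψ.continuous
    fun t ht => key t ht t.2)

open Classical in
theorem exists_classProj (x : ConjClasses G) (n : ℕ) :
    ∃ P : TensorPow (EllOne G) n →L[ℂ] classPart x n, ∀ g, P (elem fun k => delta (g k)) =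
      if hg : ConjClasses.mk (List.ofFn g).prod = x then classElem g hg else 0 := by
  refine exists_tensor_delta ⟨1, fun g => ?_⟩
  split_ifs with hg
  · exact norm_classElem_le g hg
  · simp

/-- The projection of the tensor power onto its part at `x`: it annihilates the tensors of point
masses `δ_{g₁} ⊗ ⋯ ⊗ δ_{gₙ}` with `g₁ ⋯ gₙ ∉ x`. -/
def classProj (x : ConjClasses G) (n : ℕ) : TensorPow (EllOne G) n →L[ℂ] classPart x n :=
  (exists_classProj x n).choose

theorem classProj_of_eq {x : ConjClasses G} {n : ℕ} (g : Fin n → G)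
    (hg : ConjClasses.mk (List.ofFn g).prod = x) :
    classProj x n (elem fun k => delta (g k)) = classElem g hg := by
  rw [classProj, (exists_classProj x n).choose_spec, dif_pos hg]

theorem classProj_of_ne {x : ConjClasses G} {n : ℕ} (g : Fin n → G)
    (hg : ConjClasses.mk (List.ofFn g).prod ≠ x) :
    classProj x n (elem fun k => delta (g k)) = 0 := by
  rw [classProj, (exists_classProj x n).choose_spec, dif_neg hg]

theorem classProj_comp_subtypeL (x : ConjClasses G) (n : ℕ) :
    (classProj x n).comp (classPart x n).subtypeL = ContinuousLinearMap.id ℂ _ :=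
  classPart_ext fun g hg => classProj_of_eq g hg

theorem classProj_comp_subtypeL_of_ne {x y : ConjClasses G} (hxy : x ≠ y) (n : ℕ) :
    (classProj x n).comp (classPart y n).subtypeL = 0 :=
  classPart_ext fun g hg => classProj_of_ne g (hg ▸ hxy.symm)

theorem restrict_extend {x : ConjClasses G} {n : ℕ} (φ : classPart x n →L[ℂ] ℂ) :
    (φ.comp (classProj x n)).comp (classPart x n).subtypeL = φ := by
  rw [ContinuousLinearMap.comp_assoc, classProj_comp_subtypeL, ContinuousLinearMap.comp_id]

theorem restrict_extend_of_ne {x y : ConjClasses G} (hxy : x ≠ y) {n : ℕ}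
    (φ : classPart x n →L[ℂ] ℂ) :
    (φ.comp (classProj x n)).comp (classPart y n).subtypeL = 0 := by
  rw [ContinuousLinearMap.comp_assoc, classProj_comp_subtypeL_of_ne hxy,
    ContinuousLinearMap.comp_zero]

theorem mk_prod_cyclicFace {n : ℕ} (i : Fin (n + 2)) (g : Fin (n + 2) → G) :
    ConjClasses.mk (List.ofFn (cyclicFace i g)).prod = ConjClasses.mk (List.ofFn g).prod :=
  ConjClasses.mk_eq_mk_iff_isConj.2 (prod_cyclicFace i g)

theorem hochschildB_delta {n : ℕ} (g : Fin (n + 2) → G) :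
    hochschildB (EllOne G) n (elem fun k => delta (g k)) =
      ∑ i : Fin (n + 2), (-1 : ℂ) ^ (i : ℕ) • elem fun k => delta (cyclicFace i g k) := by
  rw [hochschildB_elem]
  refine Finset.sum_congr rfl fun i _ => ?_
  rw [← map_cyclicFace (delta (G := G)) (fun a b => (delta_mul_delta a b).symm) i g]

theorem classB_classElem {x : ConjClasses G} {n : ℕ} (g : Fin (n + 2) → G)
    (hg : ConjClasses.mk (List.ofFn g).prod = x) :
    classB x n (classElem g hg) = ∑ i : Fin (n + 2), (-1 : ℂ) ^ (i : ℕ) •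
      classElem (cyclicFace i g) ((mk_prod_cyclicFace i g).trans hg) := by
  apply Subtype.ext
  rw [Submodule.coe_sum]
  exact hochschildB_delta g

theorem classB_comp_classProj (x : ConjClasses G) (n : ℕ) :
    (classB x n).comp (classProj x (n + 2)) =
      (classProj x (n + 1)).comp (hochschildB (EllOne G) n) := by
  refine tensor_delta_ext fun g => ?_
  rw [ContinuousLinearMap.comp_apply, ContinuousLinearMap.comp_apply, hochschildB_delta, map_sum]
  simp only [map_smul]
  by_cases hg : ConjClasses.mk (List.ofFn g).prod = x
  · rw [classProj_of_eq g hg, classB_classElem]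
    exact Finset.sum_congr rfl fun i _ =>
      congrArg _ (classProj_of_eq _ ((mk_prod_cyclicFace i g).trans hg)).symm
  · rw [classProj_of_ne g hg, ContinuousLinearMap.map_zero]
    refine (Finset.sum_eq_zero fun i _ => ?_).symm
    rw [classProj_of_ne _ ((mk_prod_cyclicFace i g).trans_ne hg), smul_zero]

/-- Extension of functionals from the part at `x` by zero, on Hochschild cochains. -/
def ofClassCochains (x : ConjClasses G) : classCochains x ⟶ hochschildCochains (EllOne G) :=
  dualComplexMap (fun n => classProj x (n + 1)) (classB_comp_classProj x)

theorem ofClassCochains_comp_toClassCochains (x : ConjClasses G) :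
    ofClassCochains x ≫ toClassCochains x = 𝟙 (classCochains x) := by
  ext n φ : 3
  exact restrict_extend φ

theorem ofClassCochains_comp_toClassCochains_of_ne {x y : ConjClasses G} (hxy : x ≠ y) :
    ofClassCochains x ≫ toClassCochains y = 0 := by
  ext n φ : 3
  exact restrict_extend_of_ne hxy φ

end Projection

/-! ### The augmented homogeneous complex and its prism operator -/

section Homogeneous

variable {S : Type*}

variable (S) in
/-- The coboundary of the augmented complex of functions of `n` vertices in `S`: the alternating
sum over the deletions of a vertex. In degree `0` it is the inclusion of the constants. -/
def vertexD (n : ℕ) : ((Fin n → S) → ℂ) →ₗ[ℂ] (Fin (n + 1) → S) → ℂ :=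
  ∑ i : Fin (n + 1), (-1 : ℂ) ^ (i : ℕ) • LinearMap.funLeft ℂ ℂ fun p k => p (i.succAbove k)

theorem vertexD_apply {n : ℕ} (ψ : (Fin n → S) → ℂ) (p : Fin (n + 1) → S) :
    vertexD S n ψ p = ∑ i : Fin (n + 1), (-1 : ℂ) ^ (i : ℕ) • ψ (fun k => p (i.succAbove k)) := by
  simp [vertexD, LinearMap.funLeft]

/-- The cone with apex `q`, on functions of vertices: `(cone q ψ) p = ψ (q, p)`. -/
def cone (q : S) (n : ℕ) : ((Fin (n + 1) → S) → ℂ) →ₗ[ℂ] (Fin n → S) → ℂ :=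
  LinearMap.funLeft ℂ ℂ (Fin.cons (α := fun _ => S) q)

theorem cone_apply (q : S) {n : ℕ} (ψ : (Fin (n + 1) → S) → ℂ) (p : Fin n → S) :
    cone q n ψ p = ψ (Fin.cons (α := fun _ => S) q p) := rfl

theorem cone_vertexD (q : S) {n : ℕ} (ψ : (Fin (n + 1) → S) → ℂ) :
    cone q (n + 1) (vertexD S (n + 1) ψ) = ψ - vertexD S n (cone q n ψ) := by
  funext p
  rw [cone_apply, vertexD_apply, Fin.sum_univ_succ, Pi.sub_apply, vertexD_apply, sub_eq_add_neg,
    ← Finset.sum_neg_distrib]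
  congr 1
  · simp
  · refine Finset.sum_congr rfl fun i _ => ?_
    have h : (fun k => Fin.cons (α := fun _ => S) q p (i.succ.succAbove k)) =
        Fin.cons (α := fun _ => S) q fun k => p (i.succAbove k) := by
      funext k
      refine Fin.cases ?_ (fun k => ?_) k
      · simp
      · simp [Fin.succ_succAbove_succ]
    rw [h, cone_apply, Fin.val_succ, pow_succ]
    simp

theorem vertexD_vertexD (n : ℕ) (ψ : (Fin n → S) → ℂ) :
    vertexD S (n + 1) (vertexD S n ψ) = 0 := by
  induction n with
  | zero =>
    funext p
    simp only [vertexD_apply, Subsingleton.elim _ (default : Fin 0 → S), Fin.sum_univ_succ]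
    simp
  | succ n ih =>
    funext p
    have h := congrFun (cone_vertexD (p 0) (vertexD S (n + 1) ψ)) (Fin.tail p)
    rw [cone_apply, Fin.cons_self_tail] at h
    rw [h, cone_vertexD, map_sub, ih]
    simp

/-- The homotopy between the identity and the map induced by `ρ : S → S` on functions of vertices,
obtained by coning with apex the first vertex: in terms of chains, `T₀ = 0` and
`Tₙ₊₁ p = p₀ * (p - ρ p - Tₙ (∂ p))`. -/
def prism (ρ : S → S) : ∀ n, ((Fin (n + 1) → S) → ℂ) →ₗ[ℂ] (Fin n → S) → ℂ
  | 0 => 0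
  | n + 1 => LinearMap.pi fun p =>
      ((LinearMap.proj p : ((Fin (n + 1) → S) → ℂ) →ₗ[ℂ] ℂ) - LinearMap.proj (fun k => ρ (p k)) - (LinearMap.proj p ∘ₗ vertexD S n) ∘ₗ prism ρ n) ∘ₗ cone (p 0) (n + 1)

theorem prism_succ_apply (ρ : S → S) {n : ℕ} (ψ : (Fin (n + 2) → S) → ℂ) (p : Fin (n + 1) → S) :
    prism ρ (n + 1) ψ p = cone (p 0) (n + 1) ψ p - cone (p 0) (n + 1) ψ (fun k => ρ (p k)) -
      vertexD S n (prism ρ n (cone (p 0) (n + 1) ψ)) p := rfl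

theorem vertexD_comp_map (ρ : S → S) {n : ℕ} (ψ : (Fin n → S) → ℂ) (p : Fin (n + 1) → S) :
    vertexD S n (fun q => ψ fun k => ρ (q k)) p = vertexD S n ψ fun k => ρ (p k) := by
  simp only [vertexD_apply]

theorem prism_homotopy (ρ : S → S) {n : ℕ} (ψ : (Fin (n + 1) → S) → ℂ) (p : Fin (n + 1) → S) :
    prism ρ (n + 1) (vertexD S (n + 1) ψ) p + vertexD S n (prism ρ n ψ) p =
      ψ p - ψ fun k => ρ (p k) := by
  induction n with
  | zero =>
    rw [prism_succ_apply, cone_vertexD]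
    simp only [prism, LinearMap.zero_apply, Pi.sub_apply, vertexD_apply, Pi.zero_apply]
    simp [Subsingleton.elim _ (default : Fin 0 → S)]
  | succ n ih =>
    rw [prism_succ_apply, cone_vertexD]
    set χ := cone (p 0) (n + 1) ψ
    have h : prism ρ (n + 1) (vertexD S (n + 1) χ) =
        χ - (fun q => χ fun k => ρ (q k)) - vertexD S n (prism ρ n χ) := by
      funext q
      exact eq_sub_of_add_eq (ih χ q)
    rw [map_sub, h]
    simp only [map_sub, vertexD_vertexD, Pi.sub_apply, Pi.zero_apply, vertexD_comp_map]
    ring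

/-- The homotopy is natural in maps of the vertices that commute with `ρ`. -/
theorem prism_comp_map {ρ s : S → S} (hs : ∀ a, ρ (s a) = s (ρ a)) {n : ℕ}
    (ψ : (Fin (n + 1) → S) → ℂ) (p : Fin n → S) :
    prism ρ n (fun q => ψ fun k => s (q k)) p = prism ρ n ψ fun k => s (p k) := by
  induction n with
  | zero => rfl
  | succ n ih =>
    have h : cone (p 0) (n + 1) (fun q => ψ fun k => s (q k)) =
        fun q => cone (s (p 0)) (n + 1) ψ fun k => s (q k) := by
      funext q
      simp only [cone_apply]
      congr 1
      funext k
      refine Fin.cases ?_ (fun k => ?_) k <;> simp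
    simp only [prism_succ_apply, h]
    have h' : prism ρ n (fun q => cone (s (p 0)) (n + 1) ψ fun k => s (q k)) =
        fun q => prism ρ n (cone (s (p 0)) (n + 1) ψ) fun k => s (q k) := funext (ih _)
    rw [h', vertexD_comp_map]
    simp only [hs]

theorem norm_vertexD_le {n : ℕ} {ψ : (Fin n → S) → ℂ} {C : ℝ} (hψ : ∀ p, ‖ψ p‖ ≤ C)
    (p : Fin (n + 1) → S) : ‖vertexD S n ψ p‖ ≤ (n + 1) * C := by
  rw [vertexD_apply]
  refine (norm_sum_le_of_le Finset.univ (f := fun i : Fin (n + 1) => _) (n := fun _ => C)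
    fun i _ => ?_).trans (by simp)
  rw [norm_smul, norm_pow, norm_neg, norm_one, one_pow, one_mul]
  exact hψ _

/-- The homotopy is bounded. The constant depends only on the degree, since the apex of the cone
varies with the argument. -/
theorem exists_norm_prism_le (ρ : S → S) (n : ℕ) : ∃ K : ℝ, ∀ (ψ : (Fin (n + 1) → S) → ℂ) (C : ℝ),
    (∀ p, ‖ψ p‖ ≤ C) → ∀ p, ‖prism ρ n ψ p‖ ≤ K * C := by
  induction n with
  | zero => exact ⟨0, fun ψ C _ p => by simp [prism]⟩
  | succ n ih =>
    obtain ⟨K, hK⟩ := ih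
    refine ⟨1 + 1 + (n + 1) * K, fun ψ C hψ p => ?_⟩
    rw [prism_succ_apply]
    refine (norm_sub_le_of_le (norm_sub_le_of_le (hψ _) (hψ _))
      (norm_vertexD_le (hK _ C fun q => hψ _) p)).trans_eq ?_
    ring

end Homogeneous

/-! ### Homogeneous coordinates on the cyclic bar construction -/

section Vertices

/-- The edges `(p₀⁻¹ p₁, …, pₙ₋₁⁻¹ pₙ)` of a simplex with vertices `p₀, …, pₙ` in a group. -/
def edges {K : Type*} [Group K] {n : ℕ} (p : Fin (n + 1) → K) : Fin n → K :=
  fun k => (p k.castSucc)⁻¹ * p k.succ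

theorem prod_edges {K : Type*} [Group K] {n : ℕ} (p : Fin (n + 1) → K) :
    (List.ofFn (edges p)).prod = (p 0)⁻¹ * p (Fin.last n) := by
  induction n with
  | zero => simp
  | succ n ih =>
    have h : (fun k : Fin n => edges p k.succ) = edges fun k => p k.succ := rfl
    rw [List.ofFn_succ, List.prod_cons, h, ih]
    simp [edges, mul_assoc]

theorem barFace_edges {K : Type*} [Group K] {n : ℕ} (i : Fin (n + 2)) (p : Fin (n + 2) → K) :
    barFace i (edges p) = edges fun k => p (i.succAbove k) := by
  funext k
  obtain ⟨i, hi⟩ := i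
  obtain ⟨k, hk⟩ := k
  simp only [barFace, edges, Fin.succAbove, Fin.lt_def, Fin.castSucc_mk, Fin.succ_mk]
  split_ifs <;> first | lia | rfl | (simp [mul_assoc])

theorem exists_eq_mul_of_edges_eq {K : Type*} [Group K] {n : ℕ} {p q : Fin (n + 1) → K}
    (h : edges p = edges q) : q = fun k => q 0 * (p 0)⁻¹ * p k := by
  funext k
  induction k using Fin.induction with
  | zero => simp
  | succ k ih =>
    have hk : (p k.castSucc)⁻¹ * p k.succ = (q k.castSucc)⁻¹ * q k.succ := congrFun h k
    rw [inv_mul_eq_iff_eq_mul] at hk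
    rw [hk, ← mul_assoc, ← mul_assoc, ← ih]
    simp

variable {G : Type u} [Group G]

/-- The simplex `(pₙ⁻¹ h p₀, p₀⁻¹ p₁, …, pₙ₋₁⁻¹ pₙ)` of the cyclic bar construction. These are the
simplices at the conjugacy class of `h`, and `p` is determined by its simplex up to left
multiplication by the centralizer of `h`. -/
def vertexSimplex (h : G) {n : ℕ} (p : Fin (n + 1) → G) : Fin (n + 1) → G :=
  Fin.cons ((p (Fin.last n))⁻¹ * h * p 0) (edges p)

theorem prod_vertexSimplex (h : G) {n : ℕ} (p : Fin (n + 1) → G) :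
    (List.ofFn (vertexSimplex h p)).prod = (p (Fin.last n))⁻¹ * h * p (Fin.last n) := by
  simp only [vertexSimplex, List.ofFn_cons, List.prod_cons, prod_edges]
  group

theorem mk_prod_vertexSimplex (h : G) {n : ℕ} (p : Fin (n + 1) → G) :
    ConjClasses.mk (List.ofFn (vertexSimplex h p)).prod = ConjClasses.mk h := by
  rw [prod_vertexSimplex, ConjClasses.mk_eq_mk_iff_isConj, isConj_comm, isConj_iff]
  exact ⟨(p (Fin.last n))⁻¹, by rw [inv_inv]⟩

theorem vertexSimplex_mul (h : G) {n : ℕ} (c : Cent h) (p : Fin (n + 1) → G) :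
    vertexSimplex h (fun k => (c : G) * p k) = vertexSimplex h p := by
  have hc : (c : G) * h = h * c := Subgroup.mem_centralizer_singleton_iff.1 c.2
  funext k
  refine Fin.cases ?_ (fun k => ?_) k
  · simp only [vertexSimplex, Fin.cons_zero, mul_inv_rev, mul_assoc]
    rw [← mul_assoc h, ← hc, mul_assoc, inv_mul_cancel_left]
  · simp [vertexSimplex, edges, mul_assoc]

theorem exists_eq_mul_of_vertexSimplex_eq {h : G} {n : ℕ} {p q : Fin (n + 1) → G}
    (hpq : vertexSimplex h p = vertexSimplex h q) : ∃ c : Cent h, q = fun k => (c : G) * p k := by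
  have he := exists_eq_mul_of_edges_eq (Fin.cons_injective2 hpq).2
  refine ⟨⟨q 0 * (p 0)⁻¹, ?_⟩, he⟩
  have h0 : (p (Fin.last n))⁻¹ * h * p 0 = (q (Fin.last n))⁻¹ * h * q 0 :=
    (Fin.cons_injective2 hpq).1
  have hl := congrFun he (Fin.last n)
  rw [Subgroup.mem_centralizer_singleton_iff]
  rw [hl] at h0
  simp only [mul_inv_rev, inv_inv, mul_assoc, mul_right_inj] at h0
  have h1 := congrArg (fun y => q 0 * (p 0)⁻¹ * y * (p 0)⁻¹) h0
  simpa [mul_assoc] using h1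

theorem exists_vertexSimplex_eq {h : G} {n : ℕ} (a : Fin (n + 1) → G)
    (ha : ConjClasses.mk (List.ofFn a).prod = ConjClasses.mk h) : ∃ p, vertexSimplex h p = a := by
  have e : (List.ofFn a).prod = a 0 * (List.ofFn (Fin.tail a)).prod := by
    rw [List.ofFn_succ, List.prod_cons]
    rfl
  rw [eq_comm, ConjClasses.mk_eq_mk_iff_isConj, isConj_iff] at ha
  obtain ⟨c, hc⟩ := ha
  rw [e] at hc
  set t := (List.ofFn (Fin.tail a)).prod
  -- The first vertex conjugates `h` to the cyclic rotation `a₁ ⋯ aₙ a₀` of the product.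
  let p : Fin (n + 1) → G := fun k => c⁻¹ * t⁻¹ * Fin.partialProd (Fin.tail a) k
  have hp : edges p = Fin.tail a := by
    funext k
    simp only [edges, p, mul_inv_rev, mul_assoc, mul_inv_cancel_left, inv_inv]
    exact Fin.partialProd_right_inv (Fin.tail a) k
  have hl : p (Fin.last n) = c⁻¹ := by
    have := prod_edges p
    rw [hp, eq_inv_mul_iff_mul_eq] at this
    rw [← this]
    simp [p, t]
  refine ⟨p, ?_⟩
  have h0 : p 0 = c⁻¹ * t⁻¹ := by simp [p]
  rw [vertexSimplex, hp, hl, h0, inv_inv, ← mul_assoc, hc, mul_inv_cancel_right,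
    Fin.cons_self_tail]

theorem cyclicFace_vertexSimplex (h : G) {n : ℕ} (i : Fin (n + 2)) (p : Fin (n + 2) → G) :
    cyclicFace i (vertexSimplex h p) = vertexSimplex h fun k => p (i.succAbove k) := by
  have htail : ∀ k : Fin n, cyclicFace i (vertexSimplex h p) k.succ =
      vertexSimplex h (fun k => p (i.succAbove k)) k.succ := by
    intro k
    have hb : vertexSimplex h (fun k => p (i.succAbove k)) k.succ = barFace i (edges p) k := by
      rw [barFace_edges]
      rfl
    rw [hb]
    by_cases hl : i = Fin.last (n + 1)
    · have h1 : (k : ℕ) + 1 < n + 1 := by lia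
      simp [cyclicFace, vertexSimplex, barFace, hl, Fin.castSucc_succ]
    · simp only [cyclicFace, vertexSimplex, barFace, hl, if_false, Fin.val_succ, Fin.castSucc_succ,
        Fin.cons_succ]
  have hhead : cyclicFace i (vertexSimplex h p) 0 =
      vertexSimplex h (fun k => p (i.succAbove k)) 0 := by
    simp only [vertexSimplex, Fin.cons_zero]
    by_cases hl : i = Fin.last (n + 1)
    · subst hl
      simp [cyclicFace, edges, mul_assoc]
    · have h1 : i.succAbove (Fin.last n) = Fin.last (n + 1) :=
        Fin.succAbove_ne_last_last hl
      rw [h1]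
      by_cases hi : i = 0
      · subst hi
        simp [cyclicFace, hl, edges, mul_assoc]
      · have h2 : 0 < (i : ℕ) := Nat.pos_of_ne_zero fun h => hi (Fin.ext h)
        simp [cyclicFace, hl, h2, Fin.succAbove_ne_zero_zero hi]
  funext k
  exact Fin.cases hhead htail k

theorem centSimplex_edges (h : G) {n : ℕ} (q : Fin (n + 1) → Cent h) :
    centSimplex h (edges q) = vertexSimplex h fun k => (q k : G) := by
  have hc : (q 0 : G) * h = h * q 0 := Subgroup.mem_centralizer_singleton_iff.1 (q 0).2
  rw [centSimplex, vertexSimplex, prod_edges]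
  congr 1
  push_cast
  rw [mul_inv_rev, inv_inv, mul_assoc, hc, mul_assoc]

theorem edges_mul {K : Type*} [Group K] {n : ℕ} (c : K) (p : Fin (n + 1) → K) :
    edges (fun k => c * p k) = edges p := by
  funext k
  simp [edges, mul_assoc]

theorem edges_partialProd {K : Type*} [Group K] {n : ℕ} (g : Fin n → K) :
    edges (Fin.partialProd g) = g :=
  funext fun k => Fin.partialProd_right_inv g k

theorem exists_equivariant_retraction (K : Subgroup G) :
    ∃ ρ : G → K, (∀ (c : K) (g : G), ρ (c * g) = c * ρ g) ∧ ∀ c : K, ρ c = c := by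
  obtain ⟨T, hT, h1⟩ := K.exists_isComplement_right 1
  exact ⟨fun g => (hT.equiv g).1, fun c g => congrArg Prod.fst (hT.equiv_mul_left c g),
    fun c => hT.equiv_fst_eq_self_of_mem_of_one_mem h1 c.2⟩

/-- A retraction of `G` onto the centralizer of `h` that is equivariant under left multiplication
by the centralizer. -/
def centRetraction (h : G) : G → Cent h := (exists_equivariant_retraction (Cent h)).choose

theorem centRetraction_mul (h : G) (c : Cent h) (g : G) :
    centRetraction h (c * g) = c * centRetraction h g :=
  (exists_equivariant_retraction (Cent h)).choose_spec.1 c g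

theorem centRetraction_coe (h : G) (c : Cent h) : centRetraction h c = c :=
  (exists_equivariant_retraction (Cent h)).choose_spec.2 c

end Vertices

/-! ### Cochains at a conjugacy class as bounded invariant functions -/

section InvariantFunctions

variable {G : Type u} [Group G] (h : G)

/-- The bounded functions of `n` vertices in `G` that are invariant under left multiplication by
the centralizer of `h`. -/
def invariantFun (n : ℕ) : Submodule ℂ ((Fin n → G) → ℂ) :=
  boundedFun G n ⊓
    { carrier := {ψ | ∀ (c : Cent h) p, ψ (fun k => (c : G) * p k) = ψ p}
      zero_mem' := fun _ _ => rfl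
      add_mem' := fun ha hb c p => congrArg₂ (· + ·) (ha c p) (hb c p)
      smul_mem' := fun r _ ha c p => congrArg (r • ·) (ha c p) }

/-- Functionals on the part at the class of `h`, as functions of vertices. -/
def vertexEval (n : ℕ) :
    (classPart (ConjClasses.mk h) (n + 1) →L[ℂ] ℂ) →ₗ[ℂ] invariantFun h (n + 1) where
  toFun φ := ⟨fun p => φ (classElem (vertexSimplex h p) (mk_prod_vertexSimplex h p)),
    ⟨‖φ‖, fun _ => (φ.le_opNorm _).trans
      (mul_le_of_le_one_right (norm_nonneg φ) (norm_classElem_le _ _))⟩,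
    fun c p => by simp only [vertexSimplex_mul]⟩
  map_add' _ _ := rfl
  map_smul' _ _ := rfl

variable {h}

theorem vertexEval_injective (n : ℕ) : Function.Injective (vertexEval h n) := by
  intro φ ψ hφψ
  refine classPart_ext fun a ha => ?_
  obtain ⟨p, rfl⟩ := exists_vertexSimplex_eq a ha
  exact congrFun (congrArg Subtype.val hφψ) p

theorem vertexEval_surjective (n : ℕ) : Function.Surjective (vertexEval h n) := by
  rintro ⟨ψ, ⟨C, hC⟩, hψ⟩
  obtain ⟨φ, hφ⟩ := exists_tensor_delta
    (u := fun a => ψ (Function.invFun (vertexSimplex h) a)) ⟨C, fun _ => hC _⟩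
  refine ⟨φ.comp (classPart _ _).subtypeL, Subtype.ext (funext fun p => ?_)⟩
  refine (hφ (vertexSimplex h p)).trans ?_
  obtain ⟨c, hc⟩ := exists_eq_mul_of_vertexSimplex_eq
    (Function.invFun_eq (f := vertexSimplex h) ⟨p, rfl⟩)
  exact (hψ c _).symm.trans (congrArg ψ hc.symm)

variable (h) in
/-- The cochains at the class of `h` are the bounded functions of vertices that are invariant under
the centralizer of `h`. -/
def vertexEquiv (n : ℕ) :
    (classPart (ConjClasses.mk h) (n + 1) →L[ℂ] ℂ) ≃ₗ[ℂ] invariantFun h (n + 1) :=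
  LinearEquiv.ofBijective (vertexEval h n) ⟨vertexEval_injective n, vertexEval_surjective n⟩

theorem vertexEquiv_apply {n : ℕ} (φ : classPart (ConjClasses.mk h) (n + 1) →L[ℂ] ℂ)
    (p : Fin (n + 1) → G) : (vertexEquiv h n φ).1 p =
      φ (classElem (vertexSimplex h p) (mk_prod_vertexSimplex h p)) := rfl

theorem vertexEquiv_comp_classB {n : ℕ} (φ : classPart (ConjClasses.mk h) (n + 1) →L[ℂ] ℂ) :
    (vertexEquiv h (n + 1) (φ.comp (classB (ConjClasses.mk h) n))).1 =
      vertexD G (n + 1) (vertexEquiv h n φ).1 := by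
  funext p
  rw [vertexEquiv_apply, ContinuousLinearMap.comp_apply, classB_classElem, map_sum, vertexD_apply]
  refine Finset.sum_congr rfl fun i _ => ?_
  rw [map_smul, vertexEquiv_apply]
  simp only [cyclicFace_vertexSimplex]

theorem centEval_apply {n : ℕ} (φ : classPart (ConjClasses.mk h) (n + 1) →L[ℂ] ℂ)
    (q : Fin (n + 1) → Cent h) :
    (centEval h n φ).1 (edges q) = (vertexEquiv h n φ).1 fun k => (q k : G) := by
  have e : centTensor h (edges q) = classElem (vertexSimplex h fun k => (q k : G))
      (mk_prod_vertexSimplex h _) := by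
    apply Subtype.ext
    change elem (fun k => delta (centSimplex h (edges q) k)) = _
    rw [centSimplex_edges]
    rfl
  exact congrArg φ e

variable (h) in
/-- Extension of a bounded cochain of `B(G_h)` to an invariant function of vertices in `G`, along
the retraction onto the centralizer. -/
def retractFun (n : ℕ) : boundedFun (Cent h) n →ₗ[ℂ] invariantFun h (n + 1) where
  toFun f := ⟨fun p => f.1 (edges fun k => centRetraction h (p k)),
    comp_mem_boundedFun f.2 _, fun c p => by simp only [centRetraction_mul, edges_mul]⟩
  map_add' _ _ := rfl
  map_smul' _ _ := rfl

theorem vertexD_retractFun {n : ℕ} (f : boundedFun (Cent h) n) :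
    vertexD G (n + 1) (retractFun h n f).1 = (retractFun h (n + 1) (boundedD (Cent h) n f)).1 := by
  funext p
  refine (vertexD_apply _ _).trans (Eq.trans ?_ (boundedD_apply _ _ _).symm)
  refine Finset.sum_congr rfl fun i _ => ?_
  rw [barFace_edges]
  rfl

variable (h) in
/-- The extension of bounded cochains of `B(G_h)` to cochains at the class of `h`. -/
def centExtend : boundedCochains (Cent h) ⟶ classCochains (ConjClasses.mk h) :=
  CochainComplex.ofHom
    (fun n => ModuleCat.ofHom ((vertexEquiv h n).symm.toLinearMap ∘ₗ retractFun h n)) (by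
      intro n
      simp only [boundedCochains, classCochains, dualComplex, CochainComplex.of_d]
      ext f : 2
      apply (vertexEquiv h (n + 1)).injective
      apply Subtype.ext
      refine (vertexEquiv_comp_classB ((vertexEquiv h n).symm (retractFun h n f))).trans ?_
      rw [LinearEquiv.apply_symm_apply, vertexD_retractFun]
      exact congrArg Subtype.val ((vertexEquiv h (n + 1)).apply_symm_apply _).symm)

theorem centEval_symm_retractFun {n : ℕ} (f : boundedFun (Cent h) n) :
    centEval h n ((vertexEquiv h n).symm (retractFun h n f)) = f := by
  apply Subtype.ext
  funext g
  rw [← edges_partialProd g, centEval_apply, LinearEquiv.apply_symm_apply]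
  change f.1 (edges fun k => centRetraction h (Fin.partialProd g k : Cent h)) = _
  simp only [centRetraction_coe]

theorem centExtend_comp_centRestrict (h : G) :
    centExtend h ≫ centRestrict h = 𝟙 (boundedCochains (Cent h)) := by
  ext n f : 3
  exact centEval_symm_retractFun f

theorem retractFun_centEval {n : ℕ} (φ : classPart (ConjClasses.mk h) (n + 1) →L[ℂ] ℂ)
    (p : Fin (n + 1) → G) : (retractFun h n (centEval h n φ)).1 p =
      (vertexEquiv h n φ).1 fun k => (centRetraction h (p k) : G) :=
  centEval_apply φ _

variable (h) in
/-- The prism operator of the retraction onto the centralizer, on bounded invariant functions. -/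
def invariantPrism (n : ℕ) : invariantFun h (n + 1) →ₗ[ℂ] invariantFun h n :=
  (prism (fun g => (centRetraction h g : G)) n).restrict fun ψ hψ => by
    obtain ⟨⟨C, hC⟩, hinv⟩ := hψ
    refine ⟨?_, fun c p => ?_⟩
    · obtain ⟨K, hK⟩ := exists_norm_prism_le (fun g => (centRetraction h g : G)) n
      exact ⟨K * C, hK ψ C hC⟩
    · have hc : (fun q : Fin (n + 1) → G => ψ fun k => (c : G) * q k) = ψ := funext (hinv c)
      rw [← prism_comp_map (s := fun g => (c : G) * g), hc]
      intro g
      rw [centRetraction_mul, Subgroup.coe_mul]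

variable (h) in
/-- The homotopy operator on cochains at the class of `h`. -/
def classHomotopy (n : ℕ) : (classPart (ConjClasses.mk h) (n + 2) →L[ℂ] ℂ) →ₗ[ℂ]
    (classPart (ConjClasses.mk h) (n + 1) →L[ℂ] ℂ) :=
  (vertexEquiv h n).symm.toLinearMap ∘ₗ invariantPrism h (n + 1) ∘ₗ
    (vertexEquiv h (n + 1)).toLinearMap

theorem vertexEquiv_classHomotopy {n : ℕ} (φ : classPart (ConjClasses.mk h) (n + 2) →L[ℂ] ℂ) :
    (vertexEquiv h n (classHomotopy h n φ)).1 =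
      prism (fun g => (centRetraction h g : G)) (n + 1) (vertexEquiv h (n + 1) φ).1 :=
  congrArg Subtype.val ((vertexEquiv h n).apply_symm_apply _)

theorem classHomotopy_zero (φ : classPart (ConjClasses.mk h) 1 →L[ℂ] ℂ) :
    classHomotopy h 0 (φ.comp (classB (ConjClasses.mk h) 0)) =
      φ - (vertexEquiv h 0).symm (retractFun h 0 (centEval h 0 φ)) := by
  apply (vertexEquiv h 0).injective
  apply Subtype.ext
  funext p
  rw [vertexEquiv_classHomotopy, vertexEquiv_comp_classB, map_sub, LinearEquiv.apply_symm_apply]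
  have key := prism_homotopy (fun g => (centRetraction h g : G)) (vertexEquiv h 0 φ).1 p
  simp only [prism, LinearMap.zero_apply, map_zero, Pi.zero_apply, add_zero] at key
  exact key.trans (congrArg (_ - ·) (retractFun_centEval φ p).symm)

theorem classHomotopy_succ {n : ℕ} (φ : classPart (ConjClasses.mk h) (n + 2) →L[ℂ] ℂ) :
    classHomotopy h (n + 1) (φ.comp (classB (ConjClasses.mk h) (n + 1))) +
        (classHomotopy h n φ).comp (classB (ConjClasses.mk h) n) =
      φ - (vertexEquiv h (n + 1)).symm (retractFun h (n + 1) (centEval h (n + 1) φ)) := by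
  apply (vertexEquiv h (n + 1)).injective
  apply Subtype.ext
  funext p
  rw [map_add, map_sub, LinearEquiv.apply_symm_apply]
  change (vertexEquiv h (n + 1) (classHomotopy h (n + 1) _)).1 p +
    (vertexEquiv h (n + 1) ((classHomotopy h n φ).comp _)).1 p =
      (vertexEquiv h (n + 1) φ).1 p - (retractFun h (n + 1) (centEval h (n + 1) φ)).1 p
  rw [vertexEquiv_classHomotopy, vertexEquiv_comp_classB, vertexEquiv_comp_classB,
    vertexEquiv_classHomotopy, retractFun_centEval]
  exact prism_homotopy _ _ _

end InvariantFunctions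

/-! ### The homotopy equivalence -/

section HomotopyEquivalence

variable {G H : Type u} [Group G] [Group H]

/-- The components of the cochain homotopy between the identity and the composition of the
restriction to `B(G_h)` with the extension from it. -/
def classHomotopyHom (h : G) (i j : ℕ) (hij : (ComplexShape.up ℕ).Rel j i) :
    (classCochains (ConjClasses.mk h)).X i ⟶ (classCochains (ConjClasses.mk h)).X j := by
  obtain rfl : j + 1 = i := hij
  exact ModuleCat.ofHom (classHomotopy h j)

theorem nullHomotopicMap_classHomotopyHom (h : G) :
    Homotopy.nullHomotopicMap' (classHomotopyHom h) =
      𝟙 (classCochains (ConjClasses.mk h)) - centRestrict h ≫ centExtend h := by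
  ext n φ : 3
  cases n with
  | zero =>
    rw [Homotopy.nullHomotopicMap'_f_of_not_rel_right (k₁ := 0) (k₀ := 0 + 1) rfl fun l hl => Nat.succ_ne_zero l hl]
    simp only [classCochains, dualComplex, CochainComplex.of_d]
    exact classHomotopy_zero φ
  | succ n =>
    rw [Homotopy.nullHomotopicMap'_f (k₂ := n) (k₁ := n + 1) (k₀ := n + 1 + 1) rfl rfl]
    simp only [classCochains, dualComplex, CochainComplex.of_d]
    exact classHomotopy_succ φ

/-- Restriction to `B(G_h)` is a homotopy equivalence of cochain complexes. -/
def centHomotopyEquiv (h : G) :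
    HomotopyEquiv (classCochains (ConjClasses.mk h)) (boundedCochains (Cent h)) where
  hom := centRestrict h
  inv := centExtend h
  homotopyHomInvId := ((Homotopy.equivSubZero).symm
    ((Homotopy.ofEq (nullHomotopicMap_classHomotopyHom h).symm).trans
      (Homotopy.nullHomotopy' (classHomotopyHom h)))).symm
  homotopyInvHomId := Homotopy.ofEq (centExtend_comp_centRestrict h)

theorem centTensor_map (f : G →* H) (h : G) {n : ℕ} (g : Fin n → Cent h) :
    tensorMap (ellOneMap f) (n + 1) (elem fun k => delta (centSimplex h g k)) =
      elem fun k => delta (centSimplex (f h) (fun k => centMap f h (g k)) k) := by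
  rw [tensorMap_elem]
  congr 1
  funext k
  rw [ellOneMap_delta]
  congr 1
  refine Fin.cases ?_ (fun k => ?_) k
  · have hp : (List.ofFn fun k => centMap f h (g k)).prod = centMap f h (List.ofFn g).prod := by
      rw [map_list_prod, List.map_ofFn]
      rfl
    simp only [centSimplex, Fin.cons_zero, map_mul, map_inv, hp]
    rfl
  · rfl

theorem centRestrict_naturality (f : G →* H) (h : G) :
    centRestrict (f h) ≫ boundedCochainsMap (centMap f h) =
      classCochainsMap f (x := ConjClasses.mk h) (y := ConjClasses.mk (f h)) rfl ≫
        centRestrict h := by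
  ext n φ : 3
  apply Subtype.ext
  funext g
  exact congrArg (DFunLike.coe (F := classPart (ConjClasses.mk (f h)) (n + 1) →L[ℂ] ℂ) φ)
    (Subtype.ext (centTensor_map f h g).symm)

end HomotopyEquivalence

end

end EllOneHochschild

theorem corollary2p4p3 :
    (∀ (G : Type u) [Group G] (n : ℕ),
      ∃ ι : ∀ x : ConjClasses G, HHtClass x n ⟶ HHt (EllOne G) n,
        (∀ x, ι x ≫ toHHtClass x n = 𝟙 (HHtClass x n)) ∧
        ∀ x y, x ≠ y → ι x ≫ toHHtClass y n = 0) ∧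
    ∃ Φ : ∀ (G : Type u) [Group G] (h : G) (n : ℕ),
        HHtClass (ConjClasses.mk h) n ≅ boundedCohomology (Cent h) n,
      (∀ (G : Type u) [Group G] (h : G) (n : ℕ),
        (Φ G h n).hom = HomologicalComplex.homologyMap (centRestrict h) n) ∧
      ∀ (G H : Type u) [Group G] [Group H] (f : G →* H) (h : G) (n : ℕ),
        (Φ H (f h) n).hom ≫ boundedCohomologyMap (centMap f h) n =
          HHtClassMap f (x := ConjClasses.mk h) (y := ConjClasses.mk (f h)) rfl n ≫
            (Φ G h n).hom := by
  refine ⟨fun G _ n => ⟨fun x => HomologicalComplex.homologyMap (ofClassCochains x) n,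
    fun x => ?_, fun x y hxy => ?_⟩,
    fun G _ h n => (centHomotopyEquiv h).toHomologyIso n, fun G _ h n => rfl,
    fun G H _ _ f h n => ?_⟩
  · rw [← HomologicalComplex.homologyMap_comp, ofClassCochains_comp_toClassCochains,
      HomologicalComplex.homologyMap_id]
  · rw [← HomologicalComplex.homologyMap_comp, ofClassCochains_comp_toClassCochains_of_ne hxy,
      HomologicalComplex.homologyMap_zero]
  · change HomologicalComplex.homologyMap (centRestrict (f h)) n ≫ _ =
      _ ≫ HomologicalComplex.homologyMap (centRestrict h) n
    rw [← HomologicalComplex.homologyMap_comp, ← HomologicalComplex.homologyMap_comp,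
      centRestrict_naturality]
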